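/- Definitions. Let $X=\{x_1,\dots,x_n\}$ be a set of variables; a literal is a variable or its negation, a clause is a finite set of literals (read as their disjunction), its width is the number of its literals, and a CNF is a finite set of clauses. A random $3$-CNF with $m$ clauses on $n$ variables is obtained by choosing $m$ clauses independently and uniformly at random from the $8\binom n3$ clauses with three literals on three distinct variables of $X$. "With high probability" means with probability tending to $1$ as $n\to\infty$. Let $\theta_3$ be the infimum of all real $\theta$ such that for every real $\Delta>\theta$ a random $3$-CNF with $\lfloor\Delta n\rfloor$ clauses on $n$ variables is unsatisfiable with high probability. A Resolution refutation of a CNF $\phi$ is a sequence $M_0,\dots,M_\ell$ of sets of clauses (memory configurations) with $M_0=\emptyset$, with the empty clause in $M_\ell$, and such that each $M_i$ ($1\le i\le \ell$) arises from $M_{i-1}$ by one of: $M_i=M_{i-1}\cup\{C\}$ with $C\in\phi$; $M_i=M_{i-1}\cup\{C\vee D\}$ where $C\vee x,\ D\vee\neg x\in M_{i-1}$ for some variable $x$; $M_i\subseteq M_{i-1}$. Its total space is the maximum over $i$ of the number of literals in $M_i$, counted with repetitions, i.e. $\sum_{C\in M_i}|C|$. For a field $\mathbb F$ and formal variables $x_1,\dots,x_n,\bar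 x_1,\dots,\bar x_n$, let $tr(x)=\bar x$, $tr(\neg x)=x$, $tr(\ell_1\vee\dots\vee\ell_k)=\prod_j tr(\ell_j)$, and $tr(\phi)=\{tr(C): C\in\phi\}\cup\{x^2-x,\ x+\bar x-1: x\in X\}$. A semantical PCR refutation of a set $P$ of polynomials is a sequence $M_0,\dots,M_\ell$ of sets of polynomials with $M_0=\emptyset$, $1\in M_\ell$, and such that each $M_i$ ($1\le i\le \ell$) arises from $M_{i-1}$ by one of: $M_i=M_{i-1}\cup\{p\}$ with $p\in P$; $M_i$ is contained in the ideal generated by $M_{i-1}$; $M_i\subseteq M_{i-1}$. Its monomial space is the maximum over $i$ of the number of distinct monomials appearing in the polynomials of $M_i$ ($\infty$ if some $M_i$ involves infinitely many). Statement. For every real $\Delta>\theta_3$ there is a constant $c>0$, depending only on $\Delta$, such that, with high probability, a random $3$-CNF $\phi$ with $\lfloor\Delta n\rfloor$ clauses on $n$ variables is unsatisfiable and satisfies all of the following: (1) for every field $\mathbb F$, every semantical PCR refutation of $tr(\phi)$ over $\mathbb F$ has monomial space at least $c\,n/\log n$; (2) every Resolution refutation of $\phi$ has a memory configuration containing at least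 $c\,n/\log n$ clauses each of width at least $c\,n/\log n$; (3) every Resolution refutation of $\phi$ has total space at least $c\,n^2/\log^2 n$. -/

import Mathlib

open Filter Topology
open scoped ENNReal

namespace ProofSpace

/-! ### CNF formulas -/

/-- A literal over the variables `V`: `(x, true)` is the variable `x`, `(x, false)` is `¬ x`. -/
abbrev Literal (V : Type*) := V × Bool

/-- A clause is a disjunction of literals, represented by its set of literals. The width of `C`
is `C.card`, and the empty clause is `∅`. -/
abbrev Clause (V : Type*) := Finset (Literal V)

/-- A CNF formula, represented by its set of clauses. -/
abbrev CNF (V : Type*) := Finset (Clause V)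

/-- Some total assignment makes a literal of every clause of `φ` true. -/
def Satisfiable {V : Type*} (φ : CNF V) : Prop :=
  ∃ a : V → Bool, ∀ C ∈ φ, ∃ l ∈ C, a l.1 = l.2

/-! ### Resolution with memory configurations -/

/-- `N` is obtained from the memory configuration `M` by one step of Resolution. -/
inductive ResStep {V : Type*} [DecidableEq V] (φ : CNF V) (M : CNF V) : CNF V → Prop
  /-- axiom download -/
  | download (C : Clause V) (hC : C ∈ φ) : ResStep φ M (M ∪ {C})
  /-- inference adding: from `C ∨ x` and `D ∨ ¬ x` add `C ∨ D` -/
  | infer (C D : Clause V) (x : V) (hC : C ∪ {(x, true)} ∈ M) (hD : D ∪ {(x, false)} ∈ M) :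
      ResStep φ M (M ∪ {C ∪ D})
  /-- erasure -/
  | erase (N : CNF V) (hN : N ⊆ M) : ResStep φ M N

/-- A Resolution refutation of `φ`: memory configurations `mem 0, …, mem len`, the first of which
is empty and the last of which contains the empty clause. (The values `mem i` for `i > len`
play no role.) -/
structure ResRefutation {V : Type*} [DecidableEq V] (φ : CNF V) where
  len : ℕ
  mem : ℕ → CNF V
  mem_zero : mem 0 = ∅
  step : ∀ i < len, ResStep φ (mem i) (mem (i + 1))
  empty_mem : (∅ : Clause V) ∈ mem len

/-- Total space: the maximum over the configurations of the number of literals occurring in the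
configuration, counted with repetitions. -/
def ResRefutation.totalSpace {V : Type*} [DecidableEq V] {φ : CNF V} (π : ResRefutation φ) : ℕ :=
  (Finset.range (π.len + 1)).sup fun i => ∑ C ∈ π.mem i, C.card

/-! ### Semantical Polynomial Calculus with Resolution -/

/-- `N` is obtained from the memory configuration `M` by one step of semantical PCR, with initial
polynomials `P`. -/
inductive SemPCRStep {σ 𝔽 : Type*} [Field 𝔽] (P M : Set (MvPolynomial σ 𝔽)) :
    Set (MvPolynomial σ 𝔽) → Prop
  /-- axiom download -/
  | download (p : MvPolynomial σ 𝔽) (hp : p ∈ P) : SemPCRStep P M (M ∪ {p})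
  /-- semantical inference -/
  | infer (N : Set (MvPolynomial σ 𝔽)) (hN : N ⊆ (Ideal.span M : Ideal (MvPolynomial σ 𝔽))) :
      SemPCRStep P M N
  /-- erasure -/
  | erase (N : Set (MvPolynomial σ 𝔽)) (hN : N ⊆ M) : SemPCRStep P M N

/-- A semantical PCR refutation of `P`: memory configurations `mem 0, …, mem len`, the first of
which is empty and the last of which contains the polynomial `1`. (The values `mem i` for
`i > len` play no role.) -/
structure SemPCRRefutation {σ 𝔽 : Type*} [Field 𝔽] (P : Set (MvPolynomial σ 𝔽)) where
  len : ℕ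
  mem : ℕ → Set (MvPolynomial σ 𝔽)
  mem_zero : mem 0 = ∅
  step : ∀ i < len, SemPCRStep P (mem i) (mem (i + 1))
  one_mem : (1 : MvPolynomial σ 𝔽) ∈ mem len

/-- The monomials (as exponent vectors) that appear in some polynomial of `M`. -/
def monomialsOf {σ 𝔽 : Type*} [Field 𝔽] (M : Set (MvPolynomial σ 𝔽)) : Set (σ →₀ ℕ) :=
  {m | ∃ p ∈ M, m ∈ p.support}

/-- Monomial space: the maximum over the configurations of the number of distinct monomials
appearing in the configuration (`⊤` if some configuration contains infinitely many). -/
noncomputable def SemPCRRefutation.monomialSpace {σ 𝔽 : Type*} [Field 𝔽]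
    {P : Set (MvPolynomial σ 𝔽)} (π : SemPCRRefutation P) : ℕ∞ :=
  ⨆ i ∈ Finset.range (π.len + 1), (monomialsOf (π.mem i)).encard

/-! ### The standard encoding -/

/-- The formal variables: `Sum.inl x` is `x` and `Sum.inr x` is `x̄`. The encoding of the literal
`x` is `x̄`, and that of `¬ x` is `x`. -/
noncomputable def trLiteral {V : Type*} (𝔽 : Type*) [Field 𝔽] (l : Literal V) :
    MvPolynomial (V ⊕ V) 𝔽 :=
  if l.2 then MvPolynomial.X (Sum.inr l.1) else MvPolynomial.X (Sum.inl l.1)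

/-- The encoding of a clause is the product of the encodings of its literals. -/
noncomputable def trClause {V : Type*} (𝔽 : Type*) [Field 𝔽] (C : Clause V) :
    MvPolynomial (V ⊕ V) 𝔽 :=
  ∏ l ∈ C, trLiteral 𝔽 l

/-- The standard encoding of a CNF over the variables `V`: the encodings of the clauses, together
with the boolean axioms `x² - x` and `x + x̄ - 1` for all variables `x`. -/
noncomputable def tr {V : Type*} (𝔽 : Type*) [Field 𝔽] (φ : CNF V) :
    Set (MvPolynomial (V ⊕ V) 𝔽) :=
  {p | ∃ C ∈ φ, p = trClause 𝔽 C} ∪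
  {p | ∃ x : V, p = MvPolynomial.X (Sum.inl x) ^ 2 - MvPolynomial.X (Sum.inl x)} ∪
  {p | ∃ x : V, p = MvPolynomial.X (Sum.inl x) + MvPolynomial.X (Sum.inr x) - 1}

/-! ### Random 3-CNFs -/

/-- All `8 * n.choose 3` clauses with three literals on three distinct variables among the
`n` variables. -/
def threeClauses (n : ℕ) : Finset (Clause (Fin n)) :=
  Finset.univ.filter fun C => C.card = 3 ∧ (C.image Prod.fst).card = 3

open Classical in
/-- The probability of the event `E` for a random `3`-CNF on `n` variables whose `m` clauses are
chosen independently and uniformly at random (with repetition) from `threeClauses n`: the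
proportion, among all `m`-tuples of such clauses, of those whose conjunction has property `E`. -/
noncomputable def randomCNFProb (n m : ℕ) (E : CNF (Fin n) → Prop) : ℝ :=
  (((Fintype.piFinset fun _ : Fin m => threeClauses n).filter
      fun F => E (Finset.univ.image F)).card : ℝ) /
    ((Fintype.piFinset fun _ : Fin m => threeClauses n).card : ℝ)

/-- The constant `θ₃`: the least constant above which a random `3`-CNF of clause density `Δ`
is unsatisfiable with high probability. -/
noncomputable def theta3 : ℝ :=
  sInf {θ : ℝ | ∀ Δ : ℝ, θ < Δ →
    Tendsto (fun n : ℕ => randomCNFProb n ⌊Δ * n⌋₊ fun φ => ¬ Satisfiable φ) atTop (𝓝 1)}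

end ProofSpace

open ProofSpace

/-!
Why every refutation of a random `3`-CNF needs much space.

*Expansion.* A first moment computation (`exists_tendsto_prob_not_expands`) shows that with high
probability any `k ≤ δ * n` clauses contain at least `19 / 10 * k` variables. Unsatisfiability holds
above `theta3` by definition, once the threshold is known to be finite (`tendsto_prob_unsat`); all
other claims are deterministic consequences of the expansion.

*Covering by small pieces.* A piece is a set `A` of clauses with a set `D` of at most three variables
such that any nonempty part of `A` has more neighbours in `D` than elements. By Hall's theorem
a piece is flippable: any variable may be given any value and the clauses of `A` may still be
satisfied inside `D` (`exists_mem_pieceSat`). If all subsets of a set of `3`-clauses expand by a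
factor above `9 / 5`, then it is covered by disjoint pieces (`exists_isPieceCover`). Indeed, counting
degrees produces either a clause with two private variables, or two clauses with a private variable
each that share a variable of degree two (`exists_isolated_piece`); such a piece meets no other
clause, so it can be split off.

*A game.* Call a set of disjoint pieces good if any few clauses outside of it can still be covered by
pieces on unused variables. Good sets are closed under removing pieces, and while there are at most
`r` pieces (`r` linear in `n`), pieces can be added so as to cover a given clause or to use a given
variable (`GoodFamily.extend`): one covers together with it a largest set of clauses which
expands badly in the unused variables, and all other clauses then keep expanding well. The
factor `19 / 10` for all clauses against `9 / 5` for the unused variables is what bounds this set.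
`Extendible` records these properties, and both space bounds follow from them.

*Polynomials.* While the configurations have at most `q` monomials, one maintains at most `4 * q`
pieces, merged into flippable blocks of at most two pieces, such that the configuration vanishes on
all assignments allowed by the blocks. Inferences and erasures are harmless, an axiom is handled by
the game, and the number of pieces is then reduced (`IsMerge.locality`). As blocks allow some
assignment, the polynomial `1` is never reached (`SemPCRRefutation.le_monomialSpace`).

*Resolution.* If each configuration has fewer than `k` clauses of width above `m`, a partial
assignment falsifying the first clause that few pieces can falsify is extended along the
refutation so that all wide clauses in memory stay satisfied; then that clause cannot have been
derived (`ResRefutation.exists_many_wide`).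

All this gives bounds linear in `n` for monomial space and quadratic in `n` for total space, and
hence those with the logarithms.
-/

namespace ProofSpace

/-! ### A Hall-type theorem for expansion above `9 / 5` -/

section Hall

variable {ι V : Type*} [DecidableEq V]

/-- Every nonempty part of `A` has, inside `D`, more neighbours than elements. -/
def Surplus (nb : ι → Finset V) (A : Finset ι) (D : Finset V) : Prop :=
  ∀ A' ⊆ A, A'.Nonempty → A'.card + 1 ≤ (A'.biUnion nb ∩ D).card

/-- `F` covers `L` by disjoint small pieces: a piece is a pair `(A, D)` of a set `A ⊆ L` and a set
`D` of at most three neighbours of `A` with `Surplus nb A D`; the sets `D` are pairwise disjoint. -/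
structure IsPieceCover (nb : ι → Finset V) (L : Finset ι) (F : Finset (Finset ι × Finset V)) :
    Prop where
  subset : ∀ f ∈ F, f.1 ⊆ L
  dom_subset : ∀ f ∈ F, f.2 ⊆ f.1.biUnion nb
  card_le : ∀ f ∈ F, f.2.card ≤ 3
  surplus : ∀ f ∈ F, Surplus nb f.1 f.2
  disjoint : (F : Set (Finset ι × Finset V)).PairwiseDisjoint Prod.snd
  covers : ∀ C ∈ L, ∃ f ∈ F, C ∈ f.1

lemma surplus_singleton {nb : ι → Finset V} {C : ι} {x y : V} (hx : x ∈ nb C) (hy : y ∈ nb C)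
    (hxy : x ≠ y) : Surplus nb {C} {x, y} := by
  intro A' hA' hne
  obtain rfl : A' = {C} := (Finset.subset_singleton_iff.1 hA').resolve_left hne.ne_empty
  have : ({x, y} : Finset V) ⊆ ({C} : Finset ι).biUnion nb ∩ {x, y} := by
    intro z hz
    simp only [Finset.mem_inter, hz, and_true, Finset.singleton_biUnion]
    simp only [Finset.mem_insert, Finset.mem_singleton] at hz
    rcases hz with rfl | rfl <;> assumption
  calc _ = ({x, y} : Finset V).card := by rw [Finset.card_pair hxy, Finset.card_singleton]
    _ ≤ _ := Finset.card_le_card this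

variable [DecidableEq ι]

lemma surplus_pair {nb : ι → Finset V} {C C' : ι} {x y z : V} (hx : x ∈ nb C) (hy : y ∈ nb C)
    (hy' : y ∈ nb C') (hz : z ∈ nb C') (hxy : x ≠ y) (hxz : x ≠ z) (hyz : y ≠ z) :
    Surplus nb {C, C'} {x, y, z} := by
  intro A' hA' hne
  have key : ∀ (S : Finset V), S ⊆ A'.biUnion nb → S ⊆ {x, y, z} → A'.card + 1 ≤ S.card →
      A'.card + 1 ≤ (A'.biUnion nb ∩ {x, y, z}).card := fun S h1 h2 h3 =>
    h3.trans (Finset.card_le_card (Finset.subset_inter h1 h2))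
  have hcard : A'.card ≤ 2 := (Finset.card_le_card hA').trans Finset.card_le_two
  by_cases hC : C ∈ A' <;> by_cases hC' : C' ∈ A'
  · refine key {x, y, z} ?_ subset_rfl ?_
    · intro v hv
      simp only [Finset.mem_insert, Finset.mem_singleton] at hv
      rw [Finset.mem_biUnion]
      rcases hv with rfl | rfl | rfl
      exacts [⟨C, hC, hx⟩, ⟨C, hC, hy⟩, ⟨C', hC', hz⟩]
    · rw [Finset.card_eq_three.2 ⟨x, y, z, hxy, hxz, hyz, rfl⟩]; omega
  · have : A' ⊆ {C} := fun D hD => by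
      have := hA' hD
      simp only [Finset.mem_insert, Finset.mem_singleton] at this ⊢
      rcases this with h | rfl
      exacts [h, absurd hD hC']
    have h1 := Finset.card_le_card this
    rw [Finset.card_singleton] at h1
    refine key {x, y} ?_ (by intro v; simp only [Finset.mem_insert, Finset.mem_singleton]; tauto) ?_
    · intro v hv
      simp only [Finset.mem_insert, Finset.mem_singleton] at hv
      rw [Finset.mem_biUnion]
      rcases hv with rfl | rfl
      exacts [⟨C, hC, hx⟩, ⟨C, hC, hy⟩]
    · rw [Finset.card_pair hxy]; omega
  · have : A' ⊆ {C'} := fun D hD => by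
      have := hA' hD
      simp only [Finset.mem_insert, Finset.mem_singleton] at this ⊢
      rcases this with rfl | h
      exacts [absurd hD hC, h]
    have h1 := Finset.card_le_card this
    rw [Finset.card_singleton] at h1
    refine key {y, z} ?_ (by intro v; simp only [Finset.mem_insert, Finset.mem_singleton]; tauto) ?_
    · intro v hv
      simp only [Finset.mem_insert, Finset.mem_singleton] at hv
      rw [Finset.mem_biUnion]
      rcases hv with rfl | rfl
      exacts [⟨C', hC', hy'⟩, ⟨C', hC', hz⟩]
    · rw [Finset.card_pair hyz]; omega
  · obtain ⟨D, hD⟩ := hne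
    have := hA' hD
    simp only [Finset.mem_insert, Finset.mem_singleton] at this
    rcases this with rfl | rfl
    exacts [absurd hD hC, absurd hD hC']

/-- Counting step of the Hall-type theorem: if `L` expands by a factor above `9 / 5`, then some
piece uses only vertices with no neighbour outside of it. It is either one element `C` with two
private neighbours, or two elements with a private neighbour each and a common neighbour of
degree two. -/
lemma exists_isolated_piece {nb : ι → Finset V} {L : Finset ι} (h3 : ∀ C ∈ L, (nb C).card ≤ 3)
    (hexp : 9 * L.card < 5 * (L.biUnion nb).card) :
    ∃ A D, A ⊆ L ∧ A.Nonempty ∧ D ⊆ A.biUnion nb ∧ D.card ≤ 3 ∧ Surplus nb A D ∧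
      ∀ C ∈ L, C ∉ A → Disjoint (nb C) D := by
  by_contra hno
  push Not at hno
  set deg : V → Finset ι := fun v => L.filter fun C => v ∈ nb C with hdeg
  have mem_deg : ∀ {v C}, C ∈ deg v ↔ C ∈ L ∧ v ∈ nb C := by simp [hdeg]
  -- `priv v C`: the vertex `v` has `C` as its only neighbour
  set priv : V → ι → Prop := fun v C => deg v = {C} with hpriv
  have priv_mem : ∀ {v C}, priv v C → v ∈ nb C ∧ C ∈ L := fun {v C} h => by
    have : C ∈ deg v := by rw [h]; simp
    exact ⟨(mem_deg.1 this).2, (mem_deg.1 this).1⟩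
  have priv_only : ∀ {v C C'}, priv v C → C' ∈ L → v ∈ nb C' → C' = C := fun {v C C'} h h1 h2 => by
    have : C' ∈ deg v := mem_deg.2 ⟨h1, h2⟩
    rw [h] at this
    simpa using this
  have uniq : ∀ {x y C}, priv x C → priv y C → x = y := by
    intro x y C hx hy
    by_contra hxy
    obtain ⟨C', hC', hCC', hd⟩ := hno {C} {x, y} (by simpa using (priv_mem hx).2) (by simp)
      (by
        intro v hv
        simp only [Finset.mem_insert, Finset.mem_singleton] at hv
        rw [Finset.singleton_biUnion]
        rcases hv with rfl | rfl
        exacts [(priv_mem hx).1, (priv_mem hy).1])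
      (Finset.card_le_two.trans (by norm_num))
      (surplus_singleton (priv_mem hx).1 (priv_mem hy).1 hxy)
    refine hd (Finset.disjoint_left.2 fun v hv hv' => ?_)
    simp only [Finset.mem_insert, Finset.mem_singleton] at hv' hCC'
    rcases hv' with rfl | rfl
    exacts [hCC' (priv_only hx hC' hv), hCC' (priv_only hy hC' hv)]
  have nopair : ∀ {x y z C C'}, C ≠ C' → priv x C → priv z C' → deg y = {C, C'} → False := by
    intro x y z C C' hne hx hz hy
    have hyC : y ∈ nb C ∧ y ∈ nb C' := by
      constructor
      · exact (mem_deg.1 (by rw [hy]; simp : C ∈ deg y)).2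
      · exact (mem_deg.1 (by rw [hy]; simp : C' ∈ deg y)).2
    have hxy : x ≠ y := by
      rintro rfl
      exact hne (priv_only hx (priv_mem hz).2 hyC.2).symm
    have hyz : y ≠ z := by
      rintro rfl
      exact hne (priv_only hz (priv_mem hx).2 hyC.1)
    have hxz : x ≠ z := by
      rintro rfl
      exact hne (priv_only hz (priv_mem hx).2 (priv_mem hx).1)
    obtain ⟨E, hE, hEA, hd⟩ := hno {C, C'} {x, y, z}
      (by
        intro v hv
        simp only [Finset.mem_insert, Finset.mem_singleton] at hv
        rcases hv with rfl | rfl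
        exacts [(priv_mem hx).2, (priv_mem hz).2]) (by simp)
      (by
        intro v hv
        simp only [Finset.mem_insert, Finset.mem_singleton] at hv
        rw [Finset.mem_biUnion]
        rcases hv with rfl | rfl | rfl
        exacts [⟨C, by simp, (priv_mem hx).1⟩, ⟨C, by simp, hyC.1⟩, ⟨C', by simp, (priv_mem hz).1⟩])
      Finset.card_le_three
      (surplus_pair (priv_mem hx).1 hyC.1 hyC.2 (priv_mem hz).1 hxy hxz hyz)
    refine hd (Finset.disjoint_left.2 fun v hv hv' => ?_)
    simp only [Finset.mem_insert, Finset.mem_singleton, not_or] at hv' hEA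
    rcases hv' with rfl | rfl | rfl
    · exact hEA.1 (priv_only hx hE hv)
    · have : E ∈ deg v := mem_deg.2 ⟨hE, hv⟩
      rw [hy] at this
      simp only [Finset.mem_insert, Finset.mem_singleton] at this
      tauto
    · exact hEA.2 (priv_only hz hE hv)
  classical
  set N := L.biUnion nb with hN
  set La := L.filter fun C => ∃ v, priv v C with hLa
  set Lb := L.filter fun C => ¬ ∃ v, priv v C with hLb
  have hab : La.card + Lb.card = L.card := Finset.card_filter_add_card_filter_not _
  set N1 := N.filter fun v => (deg v).card = 1 with hN1
  set N2 := N.filter fun v => (deg v).card = 2 with hN2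
  set N3 := N.filter fun v => 3 ≤ (deg v).card with hN3
  have pos : ∀ v ∈ N, 1 ≤ (deg v).card := fun v hv => by
    obtain ⟨C, hC, hv⟩ := Finset.mem_biUnion.1 hv
    exact Finset.card_pos.2 ⟨C, mem_deg.2 ⟨hC, hv⟩⟩
  have hsum : ∑ v ∈ N, (deg v).card ≤ 3 * L.card := by
    have : ∑ v ∈ N, (deg v).card = ∑ C ∈ L, (nb C).card := by
      have h1 := Finset.sum_card_bipartiteAbove_eq_sum_card_bipartiteBelow
        (s := N) (t := L) (fun v C => v ∈ nb C)
      refine h1.trans (Finset.sum_congr rfl fun C hC => ?_)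
      congr 1
      ext v
      simp only [Finset.bipartiteBelow, Finset.mem_filter, and_iff_right_iff_imp]
      exact fun hv => Finset.mem_biUnion.2 ⟨C, hC, hv⟩
    rw [this, mul_comm]
    exact Finset.sum_le_card_nsmul _ _ _ h3
  have hcount : N.card = N1.card + N2.card + N3.card := by
    simp only [hN1, hN2, hN3, Finset.card_filter, ← Finset.sum_add_distrib]
    rw [Finset.card_eq_sum_ones]
    refine Finset.sum_congr rfl fun v hv => ?_
    have := pos v hv
    split_ifs <;> omega
  have hcount' : N1.card + 2 * N2.card + 3 * N3.card ≤ ∑ v ∈ N, (deg v).card := by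
    simp only [hN1, hN2, hN3, Finset.card_filter, ← Finset.sum_add_distrib, Finset.mul_sum]
    refine Finset.sum_le_sum fun v hv => ?_
    split_ifs <;> omega
  have hn1 : N1.card ≤ La.card := by
    have h1 : ∀ v ∈ N1, ∃ C, priv v C := fun v hv => by
      exact Finset.card_eq_one.1 (Finset.mem_filter.1 hv).2
    have : Nonempty ι := by
      obtain ⟨v, hv⟩ := Finset.card_pos.1 (show 0 < N.card by omega)
      obtain ⟨C, -, -⟩ := Finset.mem_biUnion.1 hv
      exact ⟨C⟩
    choose! g hg using h1
    refine Finset.card_le_card_of_injOn g (fun v hv => ?_) fun v hv w hw hvw => ?_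
    · exact Finset.mem_filter.2 ⟨(priv_mem (hg v hv)).2, v, hg v hv⟩
    · refine uniq (hg v hv) ?_
      rw [hvw]
      exact hg w hw
  have hn2 : N2.card ≤ 3 * Lb.card := by
    have h1 : N2 ⊆ Lb.biUnion nb := by
      intro y hy
      obtain ⟨C, C', hne, hd⟩ := Finset.card_eq_two.1 (Finset.mem_filter.1 hy).2
      have hC := mem_deg.1 (by rw [hd]; simp : C ∈ deg y)
      have hC' := mem_deg.1 (by rw [hd]; simp : C' ∈ deg y)
      rw [Finset.mem_biUnion]
      by_cases h : ∃ v, priv v C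
      · by_cases h' : ∃ v, priv v C'
        · obtain ⟨x, hx⟩ := h
          obtain ⟨z, hz⟩ := h'
          exact (nopair hne hx hz hd).elim
        · exact ⟨C', Finset.mem_filter.2 ⟨hC'.1, h'⟩, hC'.2⟩
      · exact ⟨C, Finset.mem_filter.2 ⟨hC.1, h⟩, hC.2⟩
    refine (Finset.card_le_card h1).trans ?_
    rw [mul_comm]
    exact Finset.card_biUnion_le_card_mul _ _ _ fun C hC => h3 C (Finset.mem_filter.1 hC).1
  omega

/-- In a bipartite graph with left degrees at most three in which all sets of left vertices expand
by a factor above `9 / 5`, the left side has a cover by disjoint small pieces. -/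
theorem exists_isPieceCover {nb : ι → Finset V} (L : Finset ι) (h3 : ∀ C ∈ L, (nb C).card ≤ 3)
    (hexp : ∀ A ⊆ L, A.Nonempty → 9 * A.card < 5 * (A.biUnion nb).card) :
    ∃ F, IsPieceCover nb L F := by
  induction L using Finset.strongInduction with
  | H L ih =>
    rcases L.eq_empty_or_nonempty with rfl | hne
    · exact ⟨∅, by simp, by simp, by simp, by simp, by simp, by simp⟩
    obtain ⟨A, D, hAL, hA, hD, hD3, hS, hiso⟩ :=
      exists_isolated_piece h3 (hexp L subset_rfl hne)
    obtain ⟨F, hF⟩ := ih (L \ A) (Finset.sdiff_ssubset hAL hA)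
      (fun C hC => h3 C (Finset.sdiff_subset hC))
      (fun A' hA' => hexp A' (hA'.trans Finset.sdiff_subset))
    have hdis : ∀ f ∈ F, Disjoint D f.2 := fun f hf => by
      refine Finset.disjoint_right.2 fun v hv hvD => ?_
      obtain ⟨C, hC, hvC⟩ := Finset.mem_biUnion.1 (hF.dom_subset f hf hv)
      have := Finset.mem_sdiff.1 (hF.subset f hf hC)
      exact Finset.disjoint_left.1 (hiso C this.1 this.2) hvC hvD
    refine ⟨insert (A, D) F, ?_, ?_, ?_, ?_, ?_, ?_⟩
    · exact Finset.forall_mem_insert _ _ _ |>.2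
        ⟨hAL, fun f hf => (hF.subset f hf).trans Finset.sdiff_subset⟩
    · exact Finset.forall_mem_insert _ _ _ |>.2 ⟨hD, hF.dom_subset⟩
    · exact Finset.forall_mem_insert _ _ _ |>.2 ⟨hD3, hF.card_le⟩
    · exact Finset.forall_mem_insert _ _ _ |>.2 ⟨hS, hF.surplus⟩
    · rw [Finset.coe_insert]
      exact hF.disjoint.insert fun f hf _ => hdis f hf
    · intro C hC
      by_cases h : C ∈ A
      · exact ⟨(A, D), Finset.mem_insert_self _ _, h⟩
      · obtain ⟨f, hf, hCf⟩ := hF.covers C (Finset.mem_sdiff.2 ⟨hC, h⟩)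
        exact ⟨f, Finset.mem_insert_of_mem hf, hCf⟩

end Hall

/-! ### Extendible families of pieces -/

section

variable {ι V : Type*} [DecidableEq ι]

/-- The left vertices belonging to some piece of `F`. -/
def covered (F : Finset (Finset ι × Finset V)) : Finset ι := F.biUnion Prod.fst

lemma mem_covered {F : Finset (Finset ι × Finset V)} {C : ι} :
    C ∈ covered F ↔ ∃ f ∈ F, C ∈ f.1 :=
  Finset.mem_biUnion

end

section Game

variable {ι V : Type*} [DecidableEq V]

/-- The vertices used by the pieces of `F`. -/
def dom (F : Finset (Finset ι × Finset V)) : Finset V := F.biUnion Prod.snd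

lemma mem_dom {F : Finset (Finset ι × Finset V)} {v : V} : v ∈ dom F ↔ ∃ f ∈ F, v ∈ f.2 :=
  Finset.mem_biUnion

lemma dom_mono {F F' : Finset (Finset ι × Finset V)} (h : F ⊆ F') : dom F ⊆ dom F' :=
  Finset.biUnion_subset_biUnion_of_subset_left _ h

lemma Surplus.mono {nb nb' : ι → Finset V} {A A' : Finset ι} {D D' : Finset V}
    (h : Surplus nb A D) (hA : A' ⊆ A) (hD : ∀ C ∈ A', ∀ v ∈ nb C, v ∈ D → v ∈ nb' C ∧ v ∈ D') :
    Surplus nb' A' D' := by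
  intro S hS hne
  refine (h S (hS.trans hA) hne).trans (Finset.card_le_card fun v hv => ?_)
  obtain ⟨hv, hvD⟩ := Finset.mem_inter.1 hv
  obtain ⟨C, hC, hvC⟩ := Finset.mem_biUnion.1 hv
  have := hD C (hS hC) v hvC hvD
  exact Finset.mem_inter.2 ⟨Finset.mem_biUnion.2 ⟨C, hC, this.1⟩, this.2⟩

variable [DecidableEq ι]

/-- A winning position of the cover game on the bipartite graph `nb` with left side `L`: a set of
disjoint small pieces such that any `s` left vertices outside of these pieces can still be
covered by disjoint small pieces on the unused right vertices. -/
structure GoodFamily (nb : ι → Finset V) (L : Finset ι) (s : ℕ)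
    (F : Finset (Finset ι × Finset V)) : Prop where
  subset : ∀ f ∈ F, f.1 ⊆ L
  card_le : ∀ f ∈ F, f.2.card ≤ 3
  surplus : ∀ f ∈ F, Surplus nb f.1 f.2
  disjoint : (F : Set (Finset ι × Finset V)).PairwiseDisjoint Prod.snd
  coverable : ∀ A ⊆ L, A.card ≤ s → Disjoint A (covered F) →
    ∃ G, IsPieceCover (fun C => nb C \ dom F) A G

variable {nb : ι → Finset V} {L : Finset ι} {s : ℕ} {F : Finset (Finset ι × Finset V)}

lemma GoodFamily.card_dom_le (hF : GoodFamily nb L s F) : (dom F).card ≤ 3 * F.card := by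
  rw [mul_comm]
  exact Finset.card_biUnion_le_card_mul _ _ _ hF.card_le

lemma goodFamily_empty (h3 : ∀ C ∈ L, (nb C).card ≤ 3)
    (hexp : ∀ A ⊆ L, A.card ≤ s → 19 * A.card ≤ 10 * (A.biUnion nb).card) :
    GoodFamily nb L s ∅ := by
  refine ⟨by simp, by simp, by simp, by simp, fun A hA hs _ => ?_⟩
  simp only [dom, Finset.biUnion_empty, Finset.sdiff_empty]
  refine exists_isPieceCover A (fun C hC => h3 C (hA hC)) fun A' hA' hne => ?_
  have h1 : 19 * A'.card ≤ 10 * (A'.biUnion fun C => nb C).card :=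
    hexp A' (hA'.trans hA) ((Finset.card_le_card hA').trans hs)
  have := hne.card_pos
  omega

/-- A removed piece can itself be used to cover its left vertices, so winning positions are closed
under removing pieces. -/
lemma GoodFamily.erase (hF : GoodFamily nb L s F) {f : Finset ι × Finset V} (hf : f ∈ F) :
    GoodFamily nb L s (F.erase f) := by
  have hsub : F.erase f ⊆ F := Finset.erase_subset f F
  refine ⟨fun g hg => hF.subset g (hsub hg), fun g hg => hF.card_le g (hsub hg),
    fun g hg => hF.surplus g (hsub hg), hF.disjoint.subset (by exact_mod_cast hsub),
    fun A hA hs hdis => ?_⟩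
  have hfd : ∀ v ∈ f.2, v ∉ dom (F.erase f) := fun v hv hv' => by
    obtain ⟨g, hg, hvg⟩ := mem_dom.1 hv'
    exact Finset.disjoint_left.1
      (hF.disjoint (hsub hg) hf (Finset.ne_of_mem_erase hg)) hvg hv
  have hfF : ∀ v ∈ f.2, v ∈ dom F := fun v hv => mem_dom.2 ⟨f, hf, hv⟩
  have hnb : ∀ {v C}, v ∈ nb C \ dom F → v ∈ nb C \ dom (F.erase f) := fun h => by
    rw [Finset.mem_sdiff] at h ⊢
    exact ⟨h.1, fun h' => h.2 (dom_mono hsub h')⟩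
  obtain ⟨G, hG⟩ := hF.coverable (A \ f.1) (Finset.sdiff_subset.trans hA)
    ((Finset.card_le_card Finset.sdiff_subset).trans hs) (by
      refine Finset.disjoint_left.2 fun C hC hC' => ?_
      obtain ⟨hC, hCf⟩ := Finset.mem_sdiff.1 hC
      obtain ⟨g, hg, hCg⟩ := mem_covered.1 hC'
      refine Finset.disjoint_left.1 hdis hC (mem_covered.2 ⟨g, Finset.mem_erase.2 ⟨?_, hg⟩, hCg⟩)
      rintro rfl
      exact hCf hCg)
  set A₁ := A ∩ f.1 with hA₁
  refine ⟨insert (A₁, f.2 ∩ A₁.biUnion nb) G, ?_, ?_, ?_, ?_, ?_, ?_⟩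
  · exact (Finset.forall_mem_insert _ _ _).2 ⟨Finset.inter_subset_left,
      fun g hg => (hG.subset g hg).trans Finset.sdiff_subset⟩
  · refine (Finset.forall_mem_insert _ _ _).2 ⟨fun v hv => ?_, fun g hg v hv => ?_⟩
    · obtain ⟨hvf, hv⟩ := Finset.mem_inter.1 hv
      obtain ⟨C, hC, hvC⟩ := Finset.mem_biUnion.1 hv
      exact Finset.mem_biUnion.2 ⟨C, hC, Finset.mem_sdiff.2 ⟨hvC, hfd v hvf⟩⟩
    · obtain ⟨C, hC, hvC⟩ := Finset.mem_biUnion.1 (hG.dom_subset g hg hv)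
      exact Finset.mem_biUnion.2 ⟨C, hC, hnb hvC⟩
  · exact (Finset.forall_mem_insert _ _ _).2
      ⟨(Finset.card_le_card Finset.inter_subset_left).trans (hF.card_le f hf), hG.card_le⟩
  · refine (Finset.forall_mem_insert _ _ _).2 ⟨?_, fun g hg => ?_⟩
    · refine (hF.surplus f hf).mono Finset.inter_subset_right fun C hC v hvC hvf => ?_
      exact ⟨Finset.mem_sdiff.2 ⟨hvC, hfd v hvf⟩,
        Finset.mem_inter.2 ⟨hvf, Finset.mem_biUnion.2 ⟨C, hC, hvC⟩⟩⟩
    · exact (hG.surplus g hg).mono subset_rfl fun C hC v hvC hvf => ⟨hnb hvC, hvf⟩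
  · rw [Finset.coe_insert]
    refine hG.disjoint.insert fun g hg _ => ?_
    refine Finset.disjoint_left.2 fun v hv hvg => ?_
    obtain ⟨C, hC, hvC⟩ := Finset.mem_biUnion.1 (hG.dom_subset g hg hvg)
    exact (Finset.mem_sdiff.1 hvC).2 (hfF v (Finset.mem_inter.1 hv).1)
  · intro C hC
    by_cases h : C ∈ f.1
    · exact ⟨_, Finset.mem_insert_self _ _, Finset.mem_inter.2 ⟨hC, h⟩⟩
    · obtain ⟨g, hg, hCg⟩ := hG.covers C (Finset.mem_sdiff.2 ⟨hC, h⟩)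
      exact ⟨g, Finset.mem_insert_of_mem hg, hCg⟩

lemma GoodFamily.mono (hF : GoodFamily nb L s F) {F' : Finset (Finset ι × Finset V)}
    (h : F' ⊆ F) : GoodFamily nb L s F' := by
  induction hk : (F \ F').card generalizing F with
  | zero =>
    have := Finset.sdiff_eq_empty_iff_subset.1 (Finset.card_eq_zero.1 hk)
    rwa [h.antisymm this]
  | succ k ih =>
    obtain ⟨f, hf⟩ := Finset.card_pos.1 (show 0 < (F \ F').card by omega)
    have hfF := Finset.mem_sdiff.1 hf
    refine ih (hF.erase hfF.1)
      (fun g hg => Finset.mem_erase.2 ⟨fun hgf => hfF.2 (hgf ▸ hg), h hg⟩) ?_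
    rw [Finset.erase_sdiff_comm, Finset.card_erase_of_mem hf, hk, Nat.add_sub_cancel]

/-- From a winning position with few pieces, one left vertex can be covered or one right vertex
can be used, by adding pieces. The set `A'` of left vertices which the new pieces cover is a
largest set that expands badly once the vertices in use are removed: by submodularity, the left
vertices outside of `A'` keep expanding well after all neighbours of `A'` are removed too. -/
theorem GoodFamily.extend (h3 : ∀ C ∈ L, (nb C).card ≤ 3)
    (hexp : ∀ A ⊆ L, A.card ≤ s → 19 * A.card ≤ 10 * (A.biUnion nb).card)
    (hF : GoodFamily nb L s F) (hs : 960 * F.card + 692 ≤ s) {A₀ : Finset ι} {X : Finset V}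
    (hA₀ : A₀ ⊆ L) (hA₀' : A₀.card ≤ 1) (hX : X.card ≤ 1) :
    ∃ F', GoodFamily nb L s F' ∧ F ⊆ F' ∧ A₀ ⊆ covered F' ∧ X ⊆ dom F' := by
  classical
  set B := dom F ∪ X with hB
  have hBcard : B.card ≤ 3 * F.card + 1 :=
    (Finset.card_union_le _ _).trans (Nat.add_le_add hF.card_dom_le hX)
  set U := L \ covered F with hU
  set cand := U.powerset.filter fun A => A₀ \ covered F ⊆ A ∧ A.card ≤ s ∧
    5 * (A.biUnion nb \ B).card ≤ 9 * A.card + 6 with hcand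
  have hne : cand.Nonempty := by
    refine ⟨A₀ \ covered F, Finset.mem_filter.2 ⟨Finset.mem_powerset.2
      (Finset.sdiff_subset_sdiff hA₀ subset_rfl), subset_rfl, ?_, ?_⟩⟩
    · have := Finset.card_le_card (Finset.sdiff_subset (s := A₀) (t := covered F))
      omega
    · have h1 := Finset.card_le_card (Finset.sdiff_subset (s := A₀) (t := covered F))
      have h2 : ((A₀ \ covered F).biUnion nb \ B).card ≤ (A₀ \ covered F).card * 3 :=
        (Finset.card_le_card Finset.sdiff_subset).trans
          (Finset.card_biUnion_le_card_mul _ _ _ fun C hC => h3 C (hA₀ (Finset.sdiff_subset hC)))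
      omega
  obtain ⟨A', hA', hmax⟩ := Finset.exists_max_image cand Finset.card hne
  obtain ⟨hA'U, hA₀A', hA's, hA'exp⟩ := Finset.mem_filter.1 hA'
  rw [Finset.mem_powerset] at hA'U
  have hA'L : A' ⊆ L := hA'U.trans Finset.sdiff_subset
  have hA'B : A'.card ≤ 12 + 10 * B.card := by
    have h1 := hexp A' hA'L hA's
    have h2 := Finset.le_card_sdiff B (A'.biUnion nb)
    omega
  obtain ⟨G, hG⟩ := hF.coverable A' hA'L hA's
    (Finset.disjoint_of_subset_left hA'U Finset.sdiff_disjoint)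
  have hGN : ∀ g ∈ G, ∀ v ∈ g.2, v ∈ A'.biUnion nb ∧ v ∉ dom F := fun g hg v hv => by
    obtain ⟨C, hC, hvC⟩ := Finset.mem_biUnion.1 (hG.dom_subset g hg hv)
    rw [Finset.mem_sdiff] at hvC
    exact ⟨Finset.mem_biUnion.2 ⟨C, hG.subset g hg hC, hvC.1⟩, hvC.2⟩
  -- vertices still missing are used by pieces without left vertices
  set S : Finset (Finset ι × Finset V) :=
    (X \ (dom F ∪ dom G)).image fun x => (∅, {x}) with hS
  have memS : ∀ {g}, g ∈ S → ∃ x ∈ X, x ∉ dom F ∧ x ∉ dom G ∧ g = (∅, {x}) := fun {g} hg => by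
    obtain ⟨x, hx, rfl⟩ := Finset.mem_image.1 hg
    rw [Finset.mem_sdiff, Finset.mem_union, not_or] at hx
    exact ⟨x, hx.1, hx.2.1, hx.2.2, rfl⟩
  set F' := F ∪ G ∪ S with hF'
  have memF' : ∀ {g}, g ∈ F' ↔ g ∈ F ∨ g ∈ G ∨ g ∈ S := by
    intro g
    simp only [hF', Finset.mem_union, or_assoc]
  have hdomF' : dom F' ⊆ B ∪ A'.biUnion nb := fun v hv => by
    obtain ⟨g, hg, hvg⟩ := mem_dom.1 hv
    simp only [hB, Finset.mem_union]
    rcases memF'.1 hg with hg | hg | hg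
    · exact Or.inl (Or.inl (mem_dom.2 ⟨g, hg, hvg⟩))
    · exact Or.inr (hGN g hg v hvg).1
    · obtain ⟨x, hx, -, -, rfl⟩ := memS hg
      rw [Finset.mem_singleton.1 hvg]
      exact Or.inl (Or.inr hx)
  have hdomcard : (dom F').card ≤ B.card + A'.card * 3 :=
    (Finset.card_le_card hdomF').trans <| (Finset.card_union_le _ _).trans <|
      Nat.add_le_add_left (Finset.card_biUnion_le_card_mul _ _ _ fun C hC => h3 C (hA'L hC)) _
  have hcovF' : ∀ C, C ∈ covered F ∨ C ∈ A' → C ∈ covered F' := fun C hC => by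
    rw [mem_covered]
    rcases hC with hC | hC
    · obtain ⟨g, hg, hCg⟩ := mem_covered.1 hC
      exact ⟨g, memF'.2 (Or.inl hg), hCg⟩
    · obtain ⟨g, hg, hCg⟩ := hG.covers C hC
      exact ⟨g, memF'.2 (Or.inr (Or.inl hg)), hCg⟩
  refine ⟨F', ⟨?_, ?_, ?_, ?_, ?_⟩, fun g hg => memF'.2 (Or.inl hg), ?_, ?_⟩
  · intro g hg
    rcases memF'.1 hg with hg | hg | hg
    · exact hF.subset g hg
    · exact (hG.subset g hg).trans hA'L
    · obtain ⟨x, hx, -, -, rfl⟩ := memS hg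
      exact Finset.empty_subset _
  · intro g hg
    rcases memF'.1 hg with hg | hg | hg
    · exact hF.card_le g hg
    · exact hG.card_le g hg
    · obtain ⟨x, hx, -, -, rfl⟩ := memS hg
      simp
  · intro g hg
    rcases memF'.1 hg with hg | hg | hg
    · exact hF.surplus g hg
    · exact (hG.surplus g hg).mono subset_rfl fun C hC v hv hvg =>
        ⟨(Finset.mem_sdiff.1 hv).1, hvg⟩
    · obtain ⟨x, hx, -, -, rfl⟩ := memS hg
      intro T hT hTne
      exact absurd (Finset.subset_empty.1 hT) hTne.ne_empty
  · have hFG : ∀ f ∈ F, ∀ g ∈ G, Disjoint f.2 g.2 := fun f hf g hg =>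
      Finset.disjoint_right.2 fun v hv hvf => (hGN g hg v hv).2 (mem_dom.2 ⟨f, hf, hvf⟩)
    have hFS : ∀ f ∈ F, ∀ g ∈ S, Disjoint f.2 g.2 := fun f hf g hg => by
      obtain ⟨x, -, hx, -, rfl⟩ := memS hg
      exact Finset.disjoint_singleton_right.2 fun hxf => hx (mem_dom.2 ⟨f, hf, hxf⟩)
    have hGS : ∀ f ∈ G, ∀ g ∈ S, Disjoint f.2 g.2 := fun f hf g hg => by
      obtain ⟨x, -, -, hx, rfl⟩ := memS hg
      exact Finset.disjoint_singleton_right.2 fun hxf => hx (mem_dom.2 ⟨f, hf, hxf⟩)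
    intro f hf g hg hfg
    rcases memF'.1 hf with hf | hf | hf <;> rcases memF'.1 hg with hg | hg | hg
    · exact hF.disjoint hf hg hfg
    · exact hFG f hf g hg
    · exact hFS f hf g hg
    · exact (hFG g hg f hf).symm
    · exact hG.disjoint hf hg hfg
    · exact hGS f hf g hg
    · exact (hFS g hg f hf).symm
    · exact (hGS g hg f hf).symm
    · obtain ⟨x, -, -, -, rfl⟩ := memS hf
      obtain ⟨y, -, -, -, rfl⟩ := memS hg
      refine Finset.disjoint_singleton.2 fun hxy => hfg ?_
      rw [hxy]
  · intro A hA hAs hdis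
    refine exists_isPieceCover A
      (fun C hC => (Finset.card_le_card Finset.sdiff_subset).trans (h3 C (hA hC)))
      fun E hE hEne => ?_
    by_contra hlt
    push Not at hlt
    have hEL : E ⊆ L := hE.trans hA
    have hEN : (E.biUnion fun C => nb C \ dom F') = E.biUnion nb \ dom F' := by
      ext v
      simp only [Finset.mem_biUnion, Finset.mem_sdiff]
      exact ⟨fun ⟨C, h1, h2, h3⟩ => ⟨⟨C, h1, h2⟩, h3⟩, fun ⟨⟨C, h1, h2⟩, h3⟩ => ⟨C, h1, h2, h3⟩⟩
    rw [hEN] at hlt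
    have hEs : E.card ≤ s := (Finset.card_le_card hE).trans hAs
    have hEcard : E.card ≤ 10 * (dom F').card := by
      have h1 := hexp E hEL hEs
      have h2 := Finset.le_card_sdiff (dom F') (E.biUnion nb)
      omega
    have hEnot : ∀ C ∈ E, C ∉ covered F ∧ C ∉ A' := fun C hC => by
      have := Finset.disjoint_left.1 hdis (hE hC)
      exact ⟨fun h => this (hcovF' C (Or.inl h)), fun h => this (hcovF' C (Or.inr h))⟩
    have hEA' : (E ∪ A').card = E.card + A'.card :=
      Finset.card_union_of_disjoint (Finset.disjoint_left.2 fun C hC => (hEnot C hC).2)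
    have hsub : (E ∪ A').biUnion nb \ B ⊆
        (E.biUnion nb \ dom F') ∪ (A'.biUnion nb \ B) := by
      intro v hv
      rw [Finset.mem_sdiff, Finset.union_biUnion, Finset.mem_union] at hv
      rw [Finset.mem_union, Finset.mem_sdiff, Finset.mem_sdiff]
      by_cases hvA : v ∈ A'.biUnion nb
      · exact Or.inr ⟨hvA, hv.2⟩
      · refine Or.inl ⟨hv.1.resolve_right hvA, fun h => ?_⟩
        rcases Finset.mem_union.1 (hdomF' h) with h | h
        exacts [hv.2 h, hvA h]
    have hcard := (Finset.card_le_card hsub).trans (Finset.card_union_le _ _)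
    have hmem : E ∪ A' ∈ cand := by
      refine Finset.mem_filter.2 ⟨Finset.mem_powerset.2 (Finset.union_subset (fun C hC => ?_) hA'U),
        hA₀A'.trans Finset.subset_union_right, ?_, ?_⟩
      · exact Finset.mem_sdiff.2 ⟨hEL hC, (hEnot C hC).1⟩
      · omega
      · omega
    have h1 := hmax _ hmem
    have := hEne.card_pos
    omega
  · intro C hC
    by_cases h : C ∈ covered F
    · exact hcovF' C (Or.inl h)
    · exact hcovF' C (Or.inr (hA₀A' (Finset.mem_sdiff.2 ⟨hC, h⟩)))
  · intro x hx
    by_cases h : x ∈ dom F ∪ dom G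
    · rcases Finset.mem_union.1 h with h | h
      · obtain ⟨g, hg, hxg⟩ := mem_dom.1 h
        exact mem_dom.2 ⟨g, memF'.2 (Or.inl hg), hxg⟩
      · obtain ⟨g, hg, hxg⟩ := mem_dom.1 h
        exact mem_dom.2 ⟨g, memF'.2 (Or.inr (Or.inl hg)), hxg⟩
    · refine mem_dom.2 ⟨(∅, {x}), memF'.2 (Or.inr (Or.inr ?_)), by simp⟩
      exact Finset.mem_image.2 ⟨x, Finset.mem_sdiff.2 ⟨hx, h⟩, rfl⟩

end Game

/-! ### Pieces of a CNF and their satisfying assignments -/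

section Pieces

variable {V : Type*}

/-- A piece `(A, D)` stands for the assignments to the variables `D` which satisfy the
clauses `A`. -/
abbrev Piece (V : Type*) := CNF V × Finset V

/-- The assignments which satisfy every clause of the piece by a literal on a variable of the
piece. Membership depends on the variables of the piece only. -/
def pieceSat (f : Piece V) : Set (V → Bool) :=
  {a | ∀ C ∈ f.1, ∃ l ∈ C, l.1 ∈ f.2 ∧ a l.1 = l.2}

lemma pieceSat_congr {f : Piece V} {a a' : V → Bool} (h : ∀ x ∈ f.2, a x = a' x)
    (ha : a ∈ pieceSat f) : a' ∈ pieceSat f := fun C hC => by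
  obtain ⟨l, hl, hlf, hal⟩ := ha C hC
  exact ⟨l, hl, hlf, (h _ hlf).symm.trans hal⟩

/-- Assignments prescribed on disjoint sets of variables have a common extension. -/
lemma exists_glue {κ : Type*} (T : Finset κ) (d : κ → Finset V)
    (hd : (T : Set κ).PairwiseDisjoint d) (c : κ → V → Bool) (a₀ : V → Bool) :
    ∃ a : V → Bool, (∀ k ∈ T, ∀ x ∈ d k, a x = c k x) ∧ ∀ x, (∀ k ∈ T, x ∉ d k) → a x = a₀ x := by
  classical
  refine ⟨fun x => if h : ∃ k ∈ T, x ∈ d k then c h.choose x else a₀ x, fun k hk x hx => ?_,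
    fun x hx => ?_⟩
  · have hex : ∃ k ∈ T, x ∈ d k := ⟨k, hk, hx⟩
    have : hex.choose = k := by
      by_contra hne
      exact Finset.disjoint_left.1 (hd hex.choose_spec.1 hk hne) hex.choose_spec.2 hx
    simp only [dif_pos hex, this]
  · refine dif_neg ?_
    rintro ⟨k, hk, hxk⟩
    exact hx k hk hxk

variable [DecidableEq V]

/-- The variables of a clause. -/
def clauseVars (C : Clause V) : Finset V := C.image Prod.fst

/-- Pieces with a surplus are flippable: any one variable may be given any value, because Hall's
theorem assigns distinct other variables of the piece to its clauses. -/
lemma exists_mem_pieceSat {f : Piece V} (hf : Surplus clauseVars f.1 f.2) (x : V) (v : Bool) :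
    ∃ a ∈ pieceSat f, a x = v := by
  classical
  obtain ⟨g, hg, hgm⟩ := (Finset.all_card_le_biUnion_card_iff_exists_injective
    (fun C : {C // C ∈ f.1} => (clauseVars C.1 ∩ f.2).erase x)).1 (fun S => by
      rcases S.eq_empty_or_nonempty with rfl | hne
      · simp
      have h1 := hf (S.map (Function.Embedding.subtype _)) (fun C hC => by
        obtain ⟨D, -, rfl⟩ := Finset.mem_map.1 hC
        exact D.2) (by simpa using hne)
      rw [Finset.card_map] at h1
      have h2 : (S.biUnion fun C => (clauseVars C.1 ∩ f.2).erase x) =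
          ((S.map (Function.Embedding.subtype _)).biUnion clauseVars ∩ f.2).erase x := by
        ext y
        simp only [Finset.mem_biUnion, Finset.mem_erase, Finset.mem_inter, Finset.mem_map,
          Function.Embedding.subtype_apply]
        constructor
        · rintro ⟨C, hC, h, h', h''⟩
          exact ⟨h, ⟨C.1, ⟨C, hC, rfl⟩, h'⟩, h''⟩
        · rintro ⟨h, ⟨_, ⟨C, hC, rfl⟩, h'⟩, h''⟩
          exact ⟨C, hC, h, h', h''⟩
      rw [h2]
      have h3 := Finset.pred_card_le_card_erase
        (s := (S.map (Function.Embedding.subtype _)).biUnion clauseVars ∩ f.2) (a := x)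
      omega)
  simp only [Finset.mem_erase, Finset.mem_inter] at hgm
  have hlit : ∀ C : {C // C ∈ f.1}, ∃ l ∈ C.1, l.1 = g C := fun C =>
    Finset.mem_image.1 (hgm C).2.1
  choose l hl hlg using hlit
  refine ⟨fun y => if h : ∃ C, g C = y then (l h.choose).2 else v, fun C hC => ?_, ?_⟩
  · refine ⟨l ⟨C, hC⟩, hl ⟨C, hC⟩, ?_, ?_⟩
    · rw [hlg]; exact (hgm _).2.2
    · have hex : ∃ C', g C' = (l ⟨C, hC⟩).1 := ⟨⟨C, hC⟩, (hlg _).symm⟩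
      have : hex.choose = ⟨C, hC⟩ := hg (hex.choose_spec.trans (hlg _))
      simp only [dif_pos hex, this]
  · refine dif_neg ?_
    rintro ⟨C, hC⟩
    exact (hgm C).1 hC

/-- A family of sets of disjoint flippable pieces, closed under removing pieces, such that to at
most `r` pieces one can add pieces which satisfy a given clause of `φ`, and pieces which
contain a given variable. -/
structure Extendible (φ : CNF V) (r : ℕ) (𝓕 : Set (Finset (Piece V))) : Prop where
  empty_mem : ∅ ∈ 𝓕
  mono : ∀ {F F'}, F ∈ 𝓕 → F' ⊆ F → F' ∈ 𝓕
  surplus : ∀ {F}, F ∈ 𝓕 → ∀ f ∈ F, Surplus clauseVars f.1 f.2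
  disjoint : ∀ {F}, F ∈ 𝓕 → (F : Set (Piece V)).PairwiseDisjoint Prod.snd
  cover : ∀ {F}, F ∈ 𝓕 → F.card ≤ r → ∀ C ∈ φ, ∃ F' ∈ 𝓕, F ⊆ F' ∧ C ∈ covered F'
  query : ∀ {F}, F ∈ 𝓕 → F.card ≤ r → ∀ x, ∃ F' ∈ 𝓕, F ⊆ F' ∧ x ∈ dom F'

theorem extendible_goodFamily {φ : CNF V} {r s : ℕ} (h3 : ∀ C ∈ φ, (clauseVars C).card ≤ 3)
    (hexp : ∀ A ⊆ φ, A.card ≤ s → 19 * A.card ≤ 10 * (A.biUnion clauseVars).card)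
    (hr : 960 * r + 692 ≤ s) :
    Extendible φ r {F | GoodFamily clauseVars φ s F} where
  empty_mem := goodFamily_empty h3 hexp
  mono hF h := GoodFamily.mono hF h
  surplus hF := hF.surplus
  disjoint hF := hF.disjoint
  cover {F} hF hcard C hC := by
    obtain ⟨F', h1, h2, h3, -⟩ := GoodFamily.extend h3 hexp hF (by omega) (A₀ := {C}) (X := ∅)
      (by simpa using hC) (by simp) (by simp)
    exact ⟨F', h1, h2, by simpa using h3⟩
  query {F} hF hcard x := by
    obtain ⟨F', h1, h2, -, h3⟩ := GoodFamily.extend h3 hexp hF (by omega) (A₀ := ∅) (X := {x})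
      (by simp) (by simp) (by simp)
    exact ⟨F', h1, h2, by simpa using h3⟩

end Pieces

/-! ### Wide clauses in Resolution -/

section Resolution

variable {V : Type*} [DecidableEq V] {φ : CNF V} {r : ℕ} {𝓕 : Set (Finset (Piece V))}

/-- `a`, restricted to the variables of `G`, is a partial assignment allowed by `𝓕`. -/
structure Position (𝓕 : Set (Finset (Piece V))) (G : Finset (Piece V)) (a : V → Bool) : Prop where
  mem : G ∈ 𝓕
  sat : ∀ f ∈ G, a ∈ pieceSat f

/-- The restriction of `a` to the variables of `G` falsifies every literal of `C`. -/
def Falsifies (G : Finset (Piece V)) (a : V → Bool) (C : Clause V) : Prop :=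
  ∀ l ∈ C, l.1 ∈ dom G ∧ a l.1 ≠ l.2

/-- The restriction of `a` to the variables of `G` satisfies some literal of `C`. -/
def Satisfies (G : Finset (Piece V)) (a : V → Bool) (C : Clause V) : Prop :=
  ∃ l ∈ C, l.1 ∈ dom G ∧ a l.1 = l.2

/-- The partial assignment given by `G'` and `a'` extends the one given by `G` and `a`. -/
structure Extends (G : Finset (Piece V)) (a : V → Bool) (G' : Finset (Piece V))
    (a' : V → Bool) : Prop where
  subset : G ⊆ G'
  eq : ∀ x ∈ dom G, a' x = a x

variable {G G' G'' : Finset (Piece V)} {a a' a'' : V → Bool} {C D : Clause V}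

lemma Extends.trans (h : Extends G a G' a') (h' : Extends G' a' G'' a'') : Extends G a G'' a'' :=
  ⟨h.subset.trans h'.subset, fun x hx => (h'.eq x (dom_mono h.subset hx)).trans (h.eq x hx)⟩

lemma Falsifies.extends (hC : Falsifies G a C) (h : Extends G a G' a') : Falsifies G' a' C :=
  fun l hl => ⟨dom_mono h.subset (hC l hl).1, (h.eq _ (hC l hl).1).symm ▸ (hC l hl).2⟩

lemma Satisfies.extends (hC : Satisfies G a C) (h : Extends G a G' a') : Satisfies G' a' C := by
  obtain ⟨l, hl, hlG, hal⟩ := hC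
  exact ⟨l, hl, dom_mono h.subset hlG, (h.eq _ hlG).trans hal⟩

lemma Satisfies.not_falsifies (hC : Satisfies G a C) : ¬ Falsifies G a C := fun h => by
  obtain ⟨l, hl, -, hal⟩ := hC
  exact (h l hl).2 hal

/-- A clause of width `m` is falsified on at most `m` pieces already. -/
lemma Falsifies.exists_subset (hC : Falsifies G a C) :
    ∃ G' ⊆ G, G'.card ≤ C.card ∧ Falsifies G' a C := by
  have h : ∀ l ∈ C, ∃ f ∈ G, l.1 ∈ f.2 := fun l hl => mem_dom.1 (hC l hl).1
  choose! p hp hlp using h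
  refine ⟨C.image p, Finset.image_subset_iff.2 hp, Finset.card_image_le,
    fun l hl => ⟨?_, (hC l hl).2⟩⟩
  exact mem_dom.2 ⟨p l, Finset.mem_image_of_mem p hl, hlp l hl⟩

lemma Position.mono (h𝓕 : Extendible φ r 𝓕) (h : Position 𝓕 G a) (hG : G' ⊆ G) :
    Position 𝓕 G' a :=
  ⟨h𝓕.mono h.mem hG, fun f hf => h.sat f (hG hf)⟩

lemma Position.exists_query (h𝓕 : Extendible φ r 𝓕) (h : Position 𝓕 G a) (hr : G.card ≤ r)
    {x : V} (hx : x ∉ dom G) (v : Bool) :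
    ∃ G' a', Position 𝓕 G' a' ∧ Extends G a G' a' ∧ x ∈ dom G' ∧ a' x = v := by
  obtain ⟨F, hF, hGF, hxF⟩ := h𝓕.query h.mem hr x
  obtain ⟨f, hf, hxf⟩ := mem_dom.1 hxF
  obtain ⟨c, hc, hcx⟩ := exists_mem_pieceSat (h𝓕.surplus hF f hf) x v
  have hfG : f ∉ G := fun h' => hx (mem_dom.2 ⟨f, h', hxf⟩)
  have hdis : ∀ g ∈ G, ∀ y ∈ g.2, y ∉ f.2 := fun g hg y hy hyf =>
    Finset.disjoint_left.1 (h𝓕.disjoint hF (hGF hg) hf (fun hgf => hfG (hgf ▸ hg))) hy hyf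
  have hG : ∀ y ∈ dom G, y ∉ f.2 := fun y hy => by
    obtain ⟨g, hg, hyg⟩ := mem_dom.1 hy
    exact hdis g hg y hyg
  refine ⟨insert f G, fun y => if y ∈ f.2 then c y else a y,
    ⟨h𝓕.mono hF (Finset.insert_subset hf hGF), (Finset.forall_mem_insert _ _ _).2 ⟨?_, ?_⟩⟩,
    ⟨Finset.subset_insert _ _, fun y hy => if_neg (hG y hy)⟩, ?_, ?_⟩
  · exact pieceSat_congr (fun y hy => (if_pos hy).symm) hc
  · exact fun g hg => pieceSat_congr (fun y hy => (if_neg (hdis g hg y hy)).symm) (h.sat g hg)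
  · exact mem_dom.2 ⟨f, Finset.mem_insert_self _ _, hxf⟩
  · exact (if_pos hxf).trans hcx

lemma Position.not_falsifies_initial (h𝓕 : Extendible φ r 𝓕) (h : Position 𝓕 G a)
    (hr : G.card ≤ r) (hC : C ∈ φ) (x : V) : ¬ Falsifies G a C := by
  intro hf
  obtain ⟨F, hF, hGF, hCF⟩ := h𝓕.cover h.mem hr C hC
  obtain ⟨f, hfF, hCf⟩ := mem_covered.1 hCF
  by_cases hfG : f ∈ G
  · obtain ⟨l, hl, hlf, hal⟩ := h.sat f hfG C hCf
    exact (hf l hl).2 hal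
  · obtain ⟨c, hc, -⟩ := exists_mem_pieceSat (h𝓕.surplus hF f hfF) x true
    obtain ⟨l, hl, hlf, -⟩ := hc C hCf
    obtain ⟨g, hg, hlg⟩ := mem_dom.1 (hf l hl).1
    exact Finset.disjoint_left.1
      (h𝓕.disjoint hF (hGF hg) hfF (fun hgf => hfG (hgf ▸ hg))) hlg hlf

/-- A clause which is not falsified is satisfied by some extension. -/
lemma Position.exists_satisfies (h𝓕 : Extendible φ r 𝓕) (h : Position 𝓕 G a) (hr : G.card ≤ r)
    (hC : ¬ Falsifies G a C) :
    ∃ G' a', Position 𝓕 G' a' ∧ Extends G a G' a' ∧ Satisfies G' a' C := by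
  simp only [Falsifies, not_forall] at hC
  obtain ⟨l, hl, hlG⟩ := hC
  by_cases hx : l.1 ∈ dom G
  · refine ⟨G, a, h, ⟨subset_rfl, fun _ _ => rfl⟩, l, hl, hx, ?_⟩
    by_contra hne
    exact hlG ⟨hx, hne⟩
  · obtain ⟨G', a', h1, h2, h3, h4⟩ := h.exists_query h𝓕 hr hx l.2
    exact ⟨G', a', h1, h2, l, hl, h3, h4⟩

lemma Position.exists_falsifies_premise (h𝓕 : Extendible φ r 𝓕) (h : Position 𝓕 G a)
    (hr : G.card ≤ r) (hCD : Falsifies G a (C ∪ D)) (x : V) :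
    ∃ G' a', Position 𝓕 G' a' ∧ Extends G a G' a' ∧
      (Falsifies G' a' (C ∪ {(x, true)}) ∨ Falsifies G' a' (D ∪ {(x, false)})) := by
  obtain ⟨G', a', h1, h2, hx⟩ :
      ∃ G' a', Position 𝓕 G' a' ∧ Extends G a G' a' ∧ x ∈ dom G' := by
    by_cases hx : x ∈ dom G
    · exact ⟨G, a, h, ⟨subset_rfl, fun _ _ => rfl⟩, hx⟩
    · obtain ⟨G', a', h1, h2, h3, -⟩ := h.exists_query h𝓕 hr hx true
      exact ⟨G', a', h1, h2, h3⟩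
  have hCD' := hCD.extends h2
  refine ⟨G', a', h1, h2, ?_⟩
  cases hv : a' x
  · refine Or.inl fun l hl => ?_
    rcases Finset.mem_union.1 hl with hl | hl
    · exact hCD' l (Finset.mem_union_left _ hl)
    · rw [Finset.mem_singleton.1 hl]
      exact ⟨hx, by simp [hv]⟩
  · refine Or.inr fun l hl => ?_
    rcases Finset.mem_union.1 hl with hl | hl
    · exact hCD' l (Finset.mem_union_right _ hl)
    · rw [Finset.mem_singleton.1 hl]
      exact ⟨hx, by simp [hv]⟩

/-- If no clause of `M` is falsified on at most `m` pieces, and a position satisfies all clauses of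
`M` of width above `m`, then it falsifies no clause of the next configuration. -/
lemma Position.not_falsifies_of_step (h𝓕 : Extendible φ r 𝓕) {m : ℕ} {M N : CNF V}
    (hstep : ResStep φ M N)
    (hM : ∀ C ∈ M, ∀ G a, Position 𝓕 G a → G.card ≤ m → ¬ Falsifies G a C)
    (h : Position 𝓕 G a) (hr : G.card ≤ r) (hsat : ∀ C ∈ M, m < C.card → Satisfies G a C) :
    ∀ C ∈ N, ¬ Falsifies G a C := by
  have key : ∀ C ∈ M, ∀ G' a', Position 𝓕 G' a' → Extends G a G' a' → ¬ Falsifies G' a' C := by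
    intro C hC G' a' h' hext hfal
    by_cases hm : m < C.card
    · exact ((hsat C hC hm).extends hext).not_falsifies hfal
    · obtain ⟨G₁, hG₁, hcard, hfal₁⟩ := hfal.exists_subset
      exact hM C hC G₁ a' (h'.mono h𝓕 hG₁) (by omega) hfal₁
  have hrefl : Extends G a G a := ⟨subset_rfl, fun _ _ => rfl⟩
  cases hstep with
  | download E hE =>
    intro C hC hfal
    rcases Finset.mem_union.1 hC with hC | hC
    · exact key C hC G a h hrefl hfal
    · obtain rfl := Finset.mem_singleton.1 hC
      -- the empty clause has no neighbours, so it belongs to no piece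
      rcases C.eq_empty_or_nonempty with rfl | ⟨l, -⟩
      · obtain ⟨F, hF, -, hCF⟩ := h𝓕.cover h.mem hr _ hE
        obtain ⟨f, hfF, hCf⟩ := mem_covered.1 hCF
        have := h𝓕.surplus hF f hfF {∅} (by simpa using hCf) (by simp)
        simp [clauseVars] at this
      · exact h.not_falsifies_initial h𝓕 hr hE l.1 hfal
  | infer E E' x hE hE' =>
    intro C hC hfal
    rcases Finset.mem_union.1 hC with hC | hC
    · exact key C hC G a h hrefl hfal
    · obtain rfl := Finset.mem_singleton.1 hC
      obtain ⟨G', a', h1, h2, h3⟩ := h.exists_falsifies_premise h𝓕 hr hfal x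
      rcases h3 with h3 | h3
      exacts [key _ hE _ _ h1 h2 h3, key _ hE' _ _ h1 h2 h3]
  | erase _ hN => exact fun C hC => key C (hN hC) G a h hrefl

lemma ResStep.exists_subset_insert {M N : CNF V} (h : ResStep φ M N) :
    N ⊆ M ∨ ∃ C ∈ N, N ⊆ insert C M := by
  cases h with
  | download C hC =>
    exact Or.inr ⟨C, by simp, fun E hE => by simpa [or_comm] using hE⟩
  | infer C D x hC hD =>
    exact Or.inr ⟨C ∪ D, by simp, fun E hE => by simpa [or_comm] using hE⟩
  | erase _ hN => exact Or.inl hN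

/-- Every Resolution refutation of a CNF with an extendible family has a configuration with `k`
clauses of width above `m`. Otherwise, take the first configuration with a clause falsified by a
position with at most `m` pieces. Keeping that position fixed, all wide clauses of the
earlier configurations can be satisfied by adding one piece for each of them, and the narrow ones
are never falsified, so the first falsified clause cannot be derived. -/
theorem ResRefutation.exists_many_wide (h𝓕 : Extendible φ r 𝓕) {m k : ℕ} (hmk : m + k ≤ r)
    (π : ResRefutation φ) :
    ∃ i ≤ π.len, k ≤ ((π.mem i).filter fun C => m < C.card).card := by
  by_contra hno
  push Not at hno
  set P : ℕ → Prop := fun i => ∃ C ∈ π.mem i, ∃ G a, Position 𝓕 G a ∧ G.card ≤ m ∧ Falsifies G a C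
  classical
  have hex : ∃ i, P i := ⟨π.len, ∅, π.empty_mem, ∅, fun _ => true,
    ⟨h𝓕.empty_mem, by simp⟩, by simp, by simp [Falsifies]⟩
  set t := Nat.find hex with ht
  have htlen : t ≤ π.len := Nat.find_min' hex ⟨∅, π.empty_mem, ∅, fun _ => true,
    ⟨h𝓕.empty_mem, by simp⟩, by simp, by simp [Falsifies]⟩
  obtain ⟨C₀, hC₀, G₀, a₀, hpos₀, hcard₀, hfal₀⟩ := Nat.find_spec hex
  have hclean : ∀ j < t, ∀ C ∈ π.mem j, ∀ G a, Position 𝓕 G a → G.card ≤ m →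
      ¬ Falsifies G a C := fun j hj C hC G a h1 h2 h3 =>
    Nat.find_min hex hj ⟨C, hC, G, a, h1, h2, h3⟩
  -- only the pieces of `G₀` and one piece for each wide clause are kept
  have shrink : ∀ i ≤ π.len, ∀ G a, Position 𝓕 G a → Extends G₀ a₀ G a →
      (∀ C ∈ π.mem i, m < C.card → Satisfies G a C) →
      ∃ G', Position 𝓕 G' a ∧ G'.card ≤ r ∧ Extends G₀ a₀ G' a ∧
        ∀ C ∈ π.mem i, m < C.card → Satisfies G' a C := by
    intro i hi G a hpos hext hsat
    have h1 : ∀ C ∈ (π.mem i).filter (fun C => m < C.card), ∃ f ∈ G,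
        ∃ l ∈ C, l.1 ∈ f.2 ∧ a l.1 = l.2 := fun C hC => by
      obtain ⟨hC, hm⟩ := Finset.mem_filter.1 hC
      obtain ⟨l, hl, hlG, hal⟩ := hsat C hC hm
      obtain ⟨f, hf, hlf⟩ := mem_dom.1 hlG
      exact ⟨f, hf, l, hl, hlf, hal⟩
    choose! p hp hl using h1
    set W := (π.mem i).filter fun C => m < C.card with hW
    refine ⟨G₀ ∪ W.image p,
      hpos.mono h𝓕 (Finset.union_subset hext.subset (Finset.image_subset_iff.2 hp)), ?_,
      ⟨Finset.subset_union_left, hext.eq⟩, fun C hC hm => ?_⟩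
    · have h1 := Finset.card_union_le G₀ (W.image p)
      have h2 := Finset.card_image_le (s := W) (f := p)
      have h3 : W.card < k := hno i hi
      omega
    · have hCW : C ∈ W := Finset.mem_filter.2 ⟨hC, hm⟩
      obtain ⟨l, hlC, hlp, hal⟩ := hl C hCW
      exact ⟨l, hlC, mem_dom.2 ⟨p C, Finset.mem_union_right _
        (Finset.mem_image_of_mem p hCW), hlp⟩, hal⟩
  have main : ∀ j < t, ∃ G a, Position 𝓕 G a ∧ G.card ≤ r ∧ Extends G₀ a₀ G a ∧
      ∀ C ∈ π.mem j, m < C.card → Satisfies G a C := by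
    intro j
    induction j with
    | zero =>
      intro _
      exact ⟨G₀, a₀, hpos₀, by omega, ⟨subset_rfl, fun _ _ => rfl⟩, by simp [π.mem_zero]⟩
    | succ j ih =>
      intro hj
      obtain ⟨G, a, hpos, hr, hext, hsat⟩ := ih (by omega)
      have hstep := π.step j (by omega)
      have hnf := hpos.not_falsifies_of_step h𝓕 hstep (hclean j (by omega)) hr hsat
      obtain ⟨G', a', hpos', hext', hsat'⟩ : ∃ G' a', Position 𝓕 G' a' ∧ Extends G₀ a₀ G' a' ∧
          ∀ C ∈ π.mem (j + 1), m < C.card → Satisfies G' a' C := by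
        rcases hstep.exists_subset_insert with hN | ⟨E, hE, hN⟩
        · exact ⟨G, a, hpos, hext, fun C hC => hsat C (hN hC)⟩
        · obtain ⟨G', a', h1, h2, h3⟩ := hpos.exists_satisfies h𝓕 hr (hnf E hE)
          refine ⟨G', a', h1, hext.trans h2, fun C hC hm => ?_⟩
          rcases Finset.mem_insert.1 (hN hC) with rfl | hC
          exacts [h3, (hsat C hC hm).extends h2]
      obtain ⟨G'', h1, h2, h3, h4⟩ := shrink (j + 1) (by omega) G' a' hpos' hext' hsat'
      exact ⟨G'', a', h1, h2, h3, h4⟩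
  have ht0 : t ≠ 0 := fun h => by
    rw [← ht, h, π.mem_zero] at hC₀
    simp at hC₀
  obtain ⟨j, hj⟩ := Nat.exists_eq_succ_of_ne_zero ht0
  obtain ⟨G, a, hpos, hr, hext, hsat⟩ := main j (by omega)
  have hstep := π.step j (by omega)
  refine hpos.not_falsifies_of_step h𝓕 hstep (hclean j (by omega)) hr hsat C₀ ?_
    (hfal₀.extends hext)
  have : j + 1 = t := hj.symm
  rw [this]
  exact hC₀

lemma ResRefutation.le_totalSpace (π : ResRefutation φ) {i m k : ℕ} (hi : i ≤ π.len)
    (h : k ≤ ((π.mem i).filter fun C => m < C.card).card) : k * m ≤ π.totalSpace := by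
  calc k * m ≤ ((π.mem i).filter fun C => m < C.card).card * m := Nat.mul_le_mul_right _ h
    _ ≤ ∑ C ∈ (π.mem i).filter fun C => m < C.card, C.card :=
      Finset.card_nsmul_le_sum _ _ _ fun C hC => (Finset.mem_filter.1 hC).2.le
    _ ≤ ∑ C ∈ π.mem i, C.card := Finset.sum_le_sum_of_subset (Finset.filter_subset _ _)
    _ ≤ π.totalSpace :=
      Finset.le_sup (f := fun i => ∑ C ∈ π.mem i, C.card) (Finset.mem_range.2 (by omega))

end Resolution

/-! ### Monomial space -/

section Evaluation

variable {V : Type*} (𝔽 : Type*) [Field 𝔽]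

/-- The values of the formal variables `x` and `x̄` under a total assignment. -/
def boolPoint (a : V → Bool) : V ⊕ V → 𝔽 :=
  Sum.elim (fun x => if a x then 1 else 0) (fun x => if a x then 0 else 1)

lemma boolPoint_congr {a a' : V → Bool} {i : V ⊕ V}
    (h : a (Sum.elim id id i) = a' (Sum.elim id id i)) :
    boolPoint 𝔽 a i = boolPoint 𝔽 a' i := by
  cases i <;> simp_all [boolPoint]

lemma eval_trClause {a : V → Bool} {C : Clause V} (h : ∃ l ∈ C, a l.1 = l.2) :
    MvPolynomial.eval (boolPoint 𝔽 a) (trClause 𝔽 C) = 0 := by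
  obtain ⟨l, hl, hal⟩ := h
  rw [trClause, map_prod]
  refine Finset.prod_eq_zero hl ?_
  rw [trLiteral]
  split_ifs with h
  · simp [boolPoint, hal, h]
  · simp [boolPoint, hal, h]

lemma eval_idempotence (a : V → Bool) (x : V) :
    MvPolynomial.eval (boolPoint 𝔽 a)
      (MvPolynomial.X (Sum.inl x) ^ 2 - MvPolynomial.X (Sum.inl x)) = 0 := by
  cases h : a x <;> simp [boolPoint, h]

lemma eval_complementarity (a : V → Bool) (x : V) :
    MvPolynomial.eval (boolPoint 𝔽 a)
      (MvPolynomial.X (Sum.inl x) + MvPolynomial.X (Sum.inr x) - 1) = 0 := by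
  cases h : a x <;> simp [boolPoint, h]

/-- The value of a monomial under a total assignment. -/
def monoEval (m : V ⊕ V →₀ ℕ) (a : V → Bool) : 𝔽 := ∏ i ∈ m.support, boolPoint 𝔽 a i ^ m i

variable [DecidableEq V]

/-- The variables `x` such that `x` or `x̄` occurs in a monomial. -/
def monoVars (m : V ⊕ V →₀ ℕ) : Finset V := m.support.image (Sum.elim id id)

lemma monoEval_congr {m : V ⊕ V →₀ ℕ} {a a' : V → Bool} (h : ∀ x ∈ monoVars m, a x = a' x) :
    monoEval 𝔽 m a = monoEval 𝔽 m a' :=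
  Finset.prod_congr rfl fun i hi => by
    rw [boolPoint_congr 𝔽 (h _ (Finset.mem_image_of_mem _ hi))]

/-- Some value of any one of its variables annihilates a monomial, over every field. -/
lemma exists_forall_monoEval_eq_zero {m : V ⊕ V →₀ ℕ} {x : V} (hx : x ∈ monoVars m) :
    ∃ v : Bool, ∀ a : V → Bool, a x = v → monoEval 𝔽 m a = 0 := by
  obtain ⟨i, hi, hix⟩ := Finset.mem_image.1 hx
  have hi' : m i ≠ 0 := Finsupp.mem_support_iff.1 hi
  cases i with
  | inl y =>
    refine ⟨false, fun a ha => Finset.prod_eq_zero hi ?_⟩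
    obtain rfl : y = x := hix
    simp [boolPoint, ha, hi']
  | inr y =>
    refine ⟨true, fun a ha => Finset.prod_eq_zero hi ?_⟩
    obtain rfl : y = x := hix
    simp [boolPoint, ha, hi']

end Evaluation

section MonomialSpace

variable {V : Type*} [DecidableEq V] {φ : CNF V} {r : ℕ} {𝓕 : Set (Finset (Piece V))}

/-- A block: one or two pieces together with a set of assignments to their variables. -/
abbrev Block (V : Type*) := Finset (Piece V) × Set (V → Bool)

/-- The pieces of a set of blocks. -/
def blockPieces (𝓑 : Finset (Block V)) : Finset (Piece V) := 𝓑.biUnion Prod.fst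

/-- A set of disjoint flippable blocks, whose assignments satisfy the pieces of the block and are
determined on the variables of the block. -/
structure IsMerge (𝓑 : Finset (Block V)) : Prop where
  card_le : ∀ b ∈ 𝓑, b.1.card ≤ 2
  disjoint : (𝓑 : Set (Block V)).PairwiseDisjoint fun b => dom b.1
  sat : ∀ b ∈ 𝓑, ∀ f ∈ b.1, b.2 ⊆ pieceSat f
  congr : ∀ b ∈ 𝓑, ∀ a a' : V → Bool, (∀ x ∈ dom b.1, a x = a' x) → a ∈ b.2 → a' ∈ b.2
  flip : ∀ b ∈ 𝓑, ∀ x v, ∃ a ∈ b.2, a x = v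

/-- The assignments allowed by all blocks. -/
def mergeSat (𝓑 : Finset (Block V)) : Set (V → Bool) := {a | ∀ b ∈ 𝓑, a ∈ b.2}

lemma card_blockPieces_le {𝓑 : Finset (Block V)} (h : IsMerge 𝓑) :
    (blockPieces 𝓑).card ≤ 2 * 𝓑.card := by
  rw [mul_comm]
  exact Finset.card_biUnion_le_card_mul _ _ _ h.card_le

lemma IsMerge.nonempty [Nonempty V] {𝓑 : Finset (Block V)} (h : IsMerge 𝓑) :
    (mergeSat 𝓑).Nonempty := by
  have h1 : ∀ b ∈ 𝓑, ∃ a, a ∈ b.2 := fun b hb => by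
    obtain ⟨a, ha, -⟩ := h.flip b hb (Classical.arbitrary V) true
    exact ⟨a, ha⟩
  choose! c hc using h1
  obtain ⟨a, ha, -⟩ := exists_glue 𝓑 (fun b => dom b.1) h.disjoint c (fun _ => true)
  exact ⟨a, fun b hb => h.congr b hb _ _ (fun x hx => (ha b hb x hx).symm) (hc b hb)⟩

/-- The block of two pieces `f` and `f'` of different blocks, which allows the assignments giving
the value `v` to `x` or the value `v'` to `x'`. It is flippable: a prescription on one
piece is met together with the requested value on the other one. -/
def mergeBlock (f f' : Piece V) (x x' : V) (v v' : Bool) : Block V :=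
  ({f, f'}, {a | a ∈ pieceSat f ∧ a ∈ pieceSat f' ∧ (a x = v ∨ a x' = v')})

lemma mem_dom_pair {f f' : Piece V} {y : V} :
    y ∈ dom ({f, f'} : Finset (Piece V)) ↔ y ∈ f.2 ∨ y ∈ f'.2 := by
  simp [dom]

lemma mergeBlock_flip {f f' : Piece V} (hf : Surplus clauseVars f.1 f.2)
    (hf' : Surplus clauseVars f'.1 f'.2) (hdis : Disjoint f.2 f'.2) {x x' : V} (hx : x ∈ f.2)
    (hx' : x' ∈ f'.2) (v v' : Bool) (y : V) (w : Bool) :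
    ∃ a ∈ (mergeBlock f f' x x' v v').2, a y = w := by
  obtain ⟨c, hc, hcv⟩ := exists_mem_pieceSat hf x v
  obtain ⟨c', hc', hcv'⟩ := exists_mem_pieceSat hf' x' v'
  obtain ⟨d, hd, hdw⟩ := exists_mem_pieceSat hf y w
  obtain ⟨d', hd', hdw'⟩ := exists_mem_pieceSat hf' y w
  have hne : ∀ z ∈ f'.2, z ∉ f.2 := fun z hz hz' => Finset.disjoint_left.1 hdis hz' hz
  by_cases hy : y ∈ f.2
  · refine ⟨fun z => if z ∈ f.2 then d z else c' z,
      ⟨pieceSat_congr (fun z hz => (if_pos hz).symm) hd,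
        pieceSat_congr (fun z hz => (if_neg (hne z hz)).symm) hc', Or.inr ?_⟩, ?_⟩
    · exact (if_neg (hne x' hx')).trans hcv'
    · exact (if_pos hy).trans hdw
  · refine ⟨fun z => if z ∈ f.2 then c z else d' z,
      ⟨pieceSat_congr (fun z hz => (if_pos hz).symm) hc,
        pieceSat_congr (fun z hz => (if_neg (hne z hz)).symm) hd', Or.inl ?_⟩, ?_⟩
    · exact (if_pos hx).trans hcv
    · exact (if_neg hy).trans hdw'

/-- Locality: if polynomials with monomials in `Mon` vanish on all assignments allowed by a merge,
then they vanish on a merge with at most `4 * Mon.card` of its pieces. A maximal set `W` of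
monomials which touch at most `2 * W.card` blocks keeps these blocks. By Hall's theorem, each other
monomial gets two blocks of its own; a piece of the one and a piece of the other are merged so
as to annihilate the monomial. -/
theorem IsMerge.locality [Nonempty V] {𝔽 : Type*} [Field 𝔽] (h𝓕 : Extendible φ r 𝓕)
    {𝓑 : Finset (Block V)} (h𝓑 : IsMerge 𝓑) (hmem : blockPieces 𝓑 ∈ 𝓕) (Mon : Finset (V ⊕ V →₀ ℕ))
    {M : Set (MvPolynomial (V ⊕ V) 𝔽)} (hMon : ∀ p ∈ M, p.support ⊆ Mon)
    (hM : ∀ p ∈ M, ∀ a ∈ mergeSat 𝓑, MvPolynomial.eval (boolPoint 𝔽 a) p = 0) :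
    ∃ 𝓑', IsMerge 𝓑' ∧ blockPieces 𝓑' ∈ 𝓕 ∧ (blockPieces 𝓑').card ≤ 4 * Mon.card ∧
      ∀ p ∈ M, ∀ a ∈ mergeSat 𝓑', MvPolynomial.eval (boolPoint 𝔽 a) p = 0 := by
  classical
  set nbr : (V ⊕ V →₀ ℕ) → Finset (Block V) :=
    fun m => 𝓑.filter fun b => ∃ x ∈ monoVars m, x ∈ dom b.1 with hnbr
  have hnbr𝓑 : ∀ {S : Finset (V ⊕ V →₀ ℕ)} {b}, b ∈ S.biUnion nbr → b ∈ 𝓑 := fun {S b} hb => by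
    obtain ⟨m, -, hb⟩ := Finset.mem_biUnion.1 hb
    exact (Finset.mem_filter.1 hb).1
  obtain ⟨W, hW, hWmax⟩ := Finset.exists_max_image
    (Mon.powerset.filter fun W => (W.biUnion nbr).card ≤ 2 * W.card) Finset.card
    ⟨∅, by simp⟩
  obtain ⟨hWMon, hWcard⟩ := Finset.mem_filter.1 hW
  rw [Finset.mem_powerset] at hWMon
  set NW := W.biUnion nbr with hNW
  have hhall : ∀ U ⊆ Mon \ W, 2 * U.card ≤ (U.biUnion nbr \ NW).card := by
    intro U hU
    by_contra hlt
    push Not at hlt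
    have hUW : Disjoint W U := Finset.disjoint_right.2 fun m hm => (Finset.mem_sdiff.1 (hU hm)).2
    have h1 : (W ∪ U).card = W.card + U.card := Finset.card_union_of_disjoint hUW
    have h2 : (W ∪ U).biUnion nbr = NW ∪ (U.biUnion nbr \ NW) := by
      rw [Finset.union_biUnion, Finset.union_sdiff_self_eq_union]
    have h3 := Finset.card_union_le NW (U.biUnion nbr \ NW)
    have h4 := hWmax (W ∪ U) (Finset.mem_filter.2 ⟨Finset.mem_powerset.2
      (Finset.union_subset hWMon (hU.trans Finset.sdiff_subset)), by rw [h2, h1]; omega⟩)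
    omega
  obtain ⟨g, hginj, hg⟩ := (Finset.all_card_le_biUnion_card_iff_exists_injective
    (fun k : {m // m ∈ Mon \ W} × Bool => nbr k.1.1 \ NW)).1 (fun S => by
      have hU : (S.image fun k => k.1.1) ⊆ Mon \ W := fun m hm => by
        obtain ⟨k, -, rfl⟩ := Finset.mem_image.1 hm
        exact k.1.2
      have h1 := hhall _ hU
      have h2 : S.card ≤ 2 * (S.image fun k => k.1.1).card := by
        have h3 : S.card ≤ ((S.image fun k => k.1.1) ×ˢ (Finset.univ : Finset Bool)).card := by
          refine Finset.card_le_card_of_injOn (fun k => (k.1.1, k.2)) (fun k hk => ?_) ?_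
          · simp only [Finset.coe_product, Set.mem_prod, Finset.mem_coe, Finset.mem_univ, and_true]
            exact Finset.mem_image_of_mem _ hk
          · rintro ⟨⟨m, hm⟩, i⟩ - ⟨⟨m', hm'⟩, i'⟩ - h
            simpa using h
        rw [Finset.card_product] at h3
        simpa [mul_comm] using h3
      refine (h2.trans h1).trans (Finset.card_le_card fun b hb => ?_)
      obtain ⟨hb, hbW⟩ := Finset.mem_sdiff.1 hb
      obtain ⟨m, hm, hb⟩ := Finset.mem_biUnion.1 hb
      obtain ⟨k, hk, rfl⟩ := Finset.mem_image.1 hm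
      exact Finset.mem_biUnion.2 ⟨k, hk, Finset.mem_sdiff.2 ⟨hb, hbW⟩⟩)
  have hgW : ∀ k, g k ∉ NW := fun k => (Finset.mem_sdiff.1 (hg k)).2
  have hg𝓑 : ∀ k, g k ∈ 𝓑 := fun k => (Finset.mem_filter.1 (Finset.mem_sdiff.1 (hg k)).1).1
  have hx : ∀ k, ∃ x ∈ monoVars k.1.1, ∃ f ∈ (g k).1, x ∈ f.2 := fun k => by
    obtain ⟨x, hx, hxg⟩ := (Finset.mem_filter.1 (Finset.mem_sdiff.1 (hg k)).1).2
    exact ⟨x, hx, mem_dom.1 hxg⟩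
  choose x hxm f hfg hxf using hx
  choose v hv using fun k => exists_forall_monoEval_eq_zero 𝔽 (hxm k)
  set new : {m // m ∈ Mon \ W} → Block V := fun m =>
    mergeBlock (f (m, true)) (f (m, false)) (x (m, true)) (x (m, false)) (v (m, true))
      (v (m, false)) with hnew
  have hf𝓑 : ∀ k, f k ∈ blockPieces 𝓑 := fun k => Finset.mem_biUnion.2 ⟨g k, hg𝓑 k, hfg k⟩
  have hfdom : ∀ k, ∀ y ∈ (f k).2, y ∈ dom (g k).1 := fun k y hy => mem_dom.2 ⟨f k, hfg k, hy⟩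
  have hgdis : ∀ k k', k ≠ k' → ∀ y ∈ dom (g k).1, y ∉ dom (g k').1 := fun k k' hne y hy hy' =>
    Finset.disjoint_left.1 (h𝓑.disjoint (hg𝓑 k) (hg𝓑 k') (hginj.ne hne)) hy hy'
  have hnewdom : ∀ m, ∀ y ∈ dom (new m).1, ∃ i, y ∈ dom (g (m, i)).1 := fun m y hy => by
    rcases mem_dom_pair.1 hy with hy | hy
    exacts [⟨true, hfdom _ y hy⟩, ⟨false, hfdom _ y hy⟩]
  set 𝓑' : Finset (Block V) := NW ∪ Finset.univ.image new with h𝓑'def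
  have mem𝓑' : ∀ {b}, b ∈ 𝓑' ↔ b ∈ NW ∨ ∃ m, b = new m := fun {b} => by
    simp only [h𝓑'def, Finset.mem_union, Finset.mem_image, Finset.mem_univ, true_and, eq_comm]
  have h𝓑' : IsMerge 𝓑' := by
    refine ⟨?_, ?_, ?_, ?_, ?_⟩
    · intro b hb
      rcases mem𝓑'.1 hb with hb | ⟨m, rfl⟩
      exacts [h𝓑.card_le b (hnbr𝓑 hb), Finset.card_le_two]
    · have h1 : ∀ b ∈ NW, ∀ m, Disjoint (dom b.1) (dom (new m).1) := fun b hb m =>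
        Finset.disjoint_right.2 fun y hy hyb => by
          obtain ⟨i, hi⟩ := hnewdom m y hy
          exact Finset.disjoint_left.1 (h𝓑.disjoint (hnbr𝓑 hb) (hg𝓑 (m, i))
            (fun h => hgW (m, i) (h ▸ hb))) hyb hi
      intro b hb b' hb' hne
      rcases mem𝓑'.1 hb with hb | ⟨m, rfl⟩ <;> rcases mem𝓑'.1 hb' with hb' | ⟨m', rfl⟩
      · exact h𝓑.disjoint (hnbr𝓑 hb) (hnbr𝓑 hb') hne
      · exact h1 b hb m'
      · exact (h1 b' hb' m).symm
      · refine Finset.disjoint_left.2 fun y hy hy' => ?_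
        obtain ⟨i, hi⟩ := hnewdom m y hy
        obtain ⟨i', hi'⟩ := hnewdom m' y hy'
        refine hgdis (m, i) (m', i') (fun h => hne ?_) y hi hi'
        rw [(Prod.mk.inj h).1]
    · intro b hb p hp a ha
      rcases mem𝓑'.1 hb with hb | ⟨m, rfl⟩
      · exact h𝓑.sat b (hnbr𝓑 hb) p hp ha
      · simp only [hnew, mergeBlock, Finset.mem_insert, Finset.mem_singleton] at hp
        rcases hp with rfl | rfl
        exacts [ha.1, ha.2.1]
    · intro b hb a a' haa' ha
      rcases mem𝓑'.1 hb with hb | ⟨m, rfl⟩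
      · exact h𝓑.congr b (hnbr𝓑 hb) a a' haa' ha
      · have e1 : ∀ y ∈ (f (m, true)).2, a y = a' y := fun y hy =>
          haa' y (mem_dom_pair.2 (Or.inl hy))
        have e2 : ∀ y ∈ (f (m, false)).2, a y = a' y := fun y hy =>
          haa' y (mem_dom_pair.2 (Or.inr hy))
        exact ⟨pieceSat_congr e1 ha.1, pieceSat_congr e2 ha.2.1,
          ha.2.2.imp (fun h => (e1 _ (hxf _)).symm.trans h) fun h => (e2 _ (hxf _)).symm.trans h⟩
    · intro b hb y w
      rcases mem𝓑'.1 hb with hb | ⟨m, rfl⟩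
      · exact h𝓑.flip b (hnbr𝓑 hb) y w
      · refine mergeBlock_flip (h𝓕.surplus hmem _ (hf𝓑 _)) (h𝓕.surplus hmem _ (hf𝓑 _))
          (Finset.disjoint_left.2 fun z hz hz' => ?_) (hxf _) (hxf _) _ _ y w
        exact hgdis (m, true) (m, false) (by simp) z (hfdom _ z hz) (hfdom _ z hz')
  refine ⟨𝓑', h𝓑', h𝓕.mono hmem fun p hp => ?_, ?_, fun p hp a ha => ?_⟩
  · obtain ⟨b, hb, hpb⟩ := Finset.mem_biUnion.1 hp
    rcases mem𝓑'.1 hb with hb | ⟨m, rfl⟩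
    · exact Finset.mem_biUnion.2 ⟨b, hnbr𝓑 hb, hpb⟩
    · simp only [hnew, mergeBlock, Finset.mem_insert, Finset.mem_singleton] at hpb
      rcases hpb with rfl | rfl
      exacts [hf𝓑 _, hf𝓑 _]
  · have h1 := card_blockPieces_le h𝓑'
    have h2 : 𝓑'.card ≤ NW.card + (Finset.univ.image new).card := Finset.card_union_le _ _
    have h3 : (Finset.univ.image new).card ≤ (Mon \ W).card :=
      Finset.card_image_le.trans (by simp)
    have h4 := Finset.card_sdiff_add_card_eq_card hWMon
    omega
  · -- the assignment `a` is changed outside of the kept blocks so that the old merge allows it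
    -- and all monomials outside of `W` vanish
    have hc : ∀ b ∈ 𝓑, ∃ c ∈ b.2, (b ∈ NW → c = a) ∧
        ∀ m : {m // m ∈ Mon \ W}, b = g (m, true) → c (x (m, true)) = v (m, true) := by
      intro b hb
      by_cases hbW : b ∈ NW
      · exact ⟨a, ha b (mem𝓑'.2 (Or.inl hbW)), fun _ => rfl, fun m hm => absurd (hm ▸ hbW) (hgW _)⟩
      by_cases hbg : ∃ m, b = g (m, true)
      · obtain ⟨m, rfl⟩ := hbg
        obtain ⟨c, hc, hcv⟩ := h𝓑.flip _ hb (x (m, true)) (v (m, true))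
        refine ⟨c, hc, fun h => absurd h hbW, fun m' hm' => ?_⟩
        obtain rfl : m = m' := congrArg Prod.fst (hginj hm')
        exact hcv
      · obtain ⟨c, hc, -⟩ := h𝓑.flip b hb (Classical.arbitrary V) true
        exact ⟨c, hc, fun h => absurd h hbW, fun m hm => absurd ⟨m, hm⟩ hbg⟩
    choose! c hcb hcW hcg using hc
    obtain ⟨a', ha', ha'out⟩ := exists_glue 𝓑 (fun b => dom b.1) h𝓑.disjoint c a
    have ha'sat : a' ∈ mergeSat 𝓑 := fun b hb =>
      h𝓑.congr b hb _ _ (fun y hy => (ha' b hb y hy).symm) (hcb b hb)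
    have hp' := hM p hp a' ha'sat
    rw [MvPolynomial.eval_eq] at hp' ⊢
    rw [← hp']
    refine Finset.sum_congr rfl fun m hm => ?_
    congr 1
    change monoEval 𝔽 m a = monoEval 𝔽 m a'
    by_cases hmW : m ∈ W
    · refine monoEval_congr 𝔽 fun y hy => ?_
      by_cases hy𝓑 : ∃ b ∈ 𝓑, y ∈ dom b.1
      · obtain ⟨b, hb, hyb⟩ := hy𝓑
        have hbW : b ∈ NW :=
          Finset.mem_biUnion.2 ⟨m, hmW, Finset.mem_filter.2 ⟨hb, y, hy, hyb⟩⟩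
        rw [ha' b hb y hyb, hcW b hb hbW]
      · exact (ha'out y fun b hb hyb => hy𝓑 ⟨b, hb, hyb⟩).symm
    · set k : {m // m ∈ Mon \ W} := ⟨m, Finset.mem_sdiff.2 ⟨hMon p hp hm, hmW⟩⟩ with hk
      have h1 : monoEval 𝔽 m a = 0 :=
        (ha (new k) (mem𝓑'.2 (Or.inr ⟨k, rfl⟩))).2.2.elim (hv (k, true) a) (hv (k, false) a)
      have h2 : monoEval 𝔽 m a' = 0 := by
        refine hv (k, true) a' ?_
        rw [ha' _ (hg𝓑 (k, true)) _ (hfdom _ _ (hxf _))]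
        exact hcg _ (hg𝓑 _) k rfl
      rw [h1, h2]

/-- Every semantical PCR refutation of a CNF with an extendible family of rank `r` has monomial
space at least `q` if `4 * q ≤ r`: otherwise every configuration vanishes on a merge with at most `4 * q`
pieces, which is impossible for a configuration containing `1`. -/
theorem SemPCRRefutation.le_monomialSpace [Nonempty V] {𝔽 : Type*} [Field 𝔽]
    (h𝓕 : Extendible φ r 𝓕) {q : ℕ} (hq : 4 * q ≤ r) (π : SemPCRRefutation (tr 𝔽 φ)) :
    (q : ℕ∞) ≤ π.monomialSpace := by
  by_contra hlt
  push Not at hlt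
  have hfin : ∀ i ≤ π.len, (monomialsOf (π.mem i)).encard ≤ q := fun i hi =>
    (le_iSup₂_of_le (f := fun i (_ : i ∈ Finset.range (π.len + 1)) =>
      (monomialsOf (π.mem i)).encard) i (Finset.mem_range.2 (by omega)) le_rfl).trans hlt.le
  have main : ∀ i ≤ π.len, ∃ 𝓑, IsMerge 𝓑 ∧ blockPieces 𝓑 ∈ 𝓕 ∧ (blockPieces 𝓑).card ≤ 4 * q ∧
      ∀ p ∈ π.mem i, ∀ a ∈ mergeSat 𝓑, MvPolynomial.eval (boolPoint 𝔽 a) p = 0 := by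
    intro i
    induction i with
    | zero =>
      intro _
      refine ⟨∅, ⟨by simp, by simp, by simp, by simp, by simp⟩, ?_, by simp [blockPieces],
        by simp [π.mem_zero]⟩
      simpa [blockPieces] using h𝓕.empty_mem
    | succ i ih =>
      intro hi
      obtain ⟨𝓑, h𝓑, hmem, hcard, hvan⟩ := ih (by omega)
      have hlocal : ∀ 𝓑₁, IsMerge 𝓑₁ → blockPieces 𝓑₁ ∈ 𝓕 →
          (∀ p ∈ π.mem (i + 1), ∀ a ∈ mergeSat 𝓑₁,
            MvPolynomial.eval (boolPoint 𝔽 a) p = 0) →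
          ∃ 𝓑, IsMerge 𝓑 ∧ blockPieces 𝓑 ∈ 𝓕 ∧ (blockPieces 𝓑).card ≤ 4 * q ∧
            ∀ p ∈ π.mem (i + 1), ∀ a ∈ mergeSat 𝓑,
              MvPolynomial.eval (boolPoint 𝔽 a) p = 0 := by
        intro 𝓑₁ h1 h2 h3
        have hf : (monomialsOf (π.mem (i + 1))).Finite := Set.finite_of_encard_le_coe (hfin _ hi)
        have hcardMon : hf.toFinset.card ≤ q := by
          have := hfin _ hi
          rw [hf.encard_eq_coe_toFinset_card] at this
          exact_mod_cast this
        obtain ⟨𝓑', h4, h5, h6, h7⟩ := h1.locality h𝓕 h2 hf.toFinset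
          (fun p hp m hm => hf.mem_toFinset.2 ⟨p, hp, hm⟩) h3
        exact ⟨𝓑', h4, h5, h6.trans (by omega), h7⟩
      have hstep := π.step i (by omega)
      generalize hN : π.mem (i + 1) = N at hstep
      rw [hN] at hlocal
      cases hstep with
      | download p hp =>
        rcases hp with (⟨C, hC, rfl⟩ | ⟨x, rfl⟩) | ⟨x, rfl⟩
        · classical
          obtain ⟨F, hF, hsub, hCF⟩ := h𝓕.cover hmem (by omega) C hC
          set new : Piece V → Block V := fun f => ({f}, pieceSat f) with hnew
          set S := (F \ blockPieces 𝓑).image new with hS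
          have memS : ∀ {b}, b ∈ S → ∃ f ∈ F, f ∉ blockPieces 𝓑 ∧ b = new f := fun {b} hb => by
            obtain ⟨f, hf, rfl⟩ := Finset.mem_image.1 hb
            exact ⟨f, (Finset.mem_sdiff.1 hf).1, (Finset.mem_sdiff.1 hf).2, rfl⟩
          have hdomnew : ∀ f, dom (new f).1 = f.2 := fun f => by simp [hnew, dom]
          have hunion : blockPieces (𝓑 ∪ S) = F := by
            ext f
            simp only [blockPieces, Finset.mem_biUnion, Finset.mem_union]
            constructor
            · rintro ⟨b, hb | hb, hfb⟩
              · exact hsub (Finset.mem_biUnion.2 ⟨b, hb, hfb⟩)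
              · obtain ⟨f', hf', -, rfl⟩ := memS hb
                rwa [Finset.mem_singleton.1 hfb]
            · intro hf
              by_cases h : f ∈ blockPieces 𝓑
              · obtain ⟨b, hb, hfb⟩ := Finset.mem_biUnion.1 h
                exact ⟨b, Or.inl hb, hfb⟩
              · exact ⟨new f, Or.inr (Finset.mem_image_of_mem _ (Finset.mem_sdiff.2 ⟨hf, h⟩)),
                  Finset.mem_singleton_self f⟩
          have hmerge : IsMerge (𝓑 ∪ S) := by
            refine ⟨?_, ?_, ?_, ?_, ?_⟩
            · intro b hb
              rcases Finset.mem_union.1 hb with hb | hb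
              · exact h𝓑.card_le b hb
              · obtain ⟨f, -, -, rfl⟩ := memS hb
                simp [hnew]
            · have h1 : ∀ b ∈ 𝓑, ∀ b' ∈ S, Disjoint (dom b.1) (dom b'.1) := by
                intro b hb b' hb'
                obtain ⟨f, hf, hf𝓑, rfl⟩ := memS hb'
                rw [hdomnew]
                refine Finset.disjoint_left.2 fun y hy hyf => ?_
                obtain ⟨f', hf', hyf'⟩ := mem_dom.1 hy
                have hf'𝓑 : f' ∈ blockPieces 𝓑 := Finset.mem_biUnion.2 ⟨b, hb, hf'⟩
                exact Finset.disjoint_left.1 (h𝓕.disjoint hF (hsub hf'𝓑) hf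
                  (fun h => hf𝓑 (h ▸ hf'𝓑))) hyf' hyf
              intro b hb b' hb' hne
              rcases Finset.mem_union.1 hb with hb | hb <;>
                rcases Finset.mem_union.1 hb' with hb' | hb'
              · exact h𝓑.disjoint hb hb' hne
              · exact h1 b hb b' hb'
              · exact (h1 b' hb' b hb).symm
              · obtain ⟨f, hf, -, rfl⟩ := memS hb
                obtain ⟨f', hf', -, rfl⟩ := memS hb'
                simp only [Function.onFun, hdomnew]
                exact h𝓕.disjoint hF hf hf' fun h => hne (by rw [h])
            · intro b hb f hfb
              rcases Finset.mem_union.1 hb with hb | hb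
              · exact h𝓑.sat b hb f hfb
              · obtain ⟨f', -, -, rfl⟩ := memS hb
                rw [Finset.mem_singleton.1 hfb]
            · intro b hb a a' haa'
              rcases Finset.mem_union.1 hb with hb | hb
              · exact h𝓑.congr b hb a a' haa'
              · obtain ⟨f, -, -, rfl⟩ := memS hb
                rw [hdomnew] at haa'
                exact pieceSat_congr haa'
            · intro b hb
              rcases Finset.mem_union.1 hb with hb | hb
              · exact h𝓑.flip b hb
              · obtain ⟨f, hf, -, rfl⟩ := memS hb
                exact exists_mem_pieceSat (h𝓕.surplus hF f hf)
          refine hlocal (𝓑 ∪ S) hmerge (hunion ▸ hF) fun p hp a ha => ?_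
          rcases hp with hp | rfl
          · exact hvan p hp a fun b hb => ha b (Finset.mem_union_left _ hb)
          · obtain ⟨f, hf, hCf⟩ := mem_covered.1 hCF
            rw [← hunion] at hf
            obtain ⟨b, hb, hfb⟩ := Finset.mem_biUnion.1 hf
            obtain ⟨l, hl, -, hal⟩ := hmerge.sat b hb f hfb (ha b hb) C hCf
            exact eval_trClause 𝔽 ⟨l, hl, hal⟩
        · refine ⟨𝓑, h𝓑, hmem, hcard, fun p hp a ha => ?_⟩
          rcases hp with hp | rfl
          exacts [hvan p hp a ha, eval_idempotence 𝔽 a x]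
        · refine ⟨𝓑, h𝓑, hmem, hcard, fun p hp a ha => ?_⟩
          rcases hp with hp | rfl
          exacts [hvan p hp a ha, eval_complementarity 𝔽 a x]
      | infer _ hN =>
        refine ⟨𝓑, h𝓑, hmem, hcard, fun p hp a ha => ?_⟩
        have hle : Ideal.span (π.mem i) ≤ RingHom.ker (MvPolynomial.eval (boolPoint 𝔽 a)) :=
          Ideal.span_le.2 fun p hp => hvan p hp a ha
        exact hle (hN hp)
      | erase _ hN => exact ⟨𝓑, h𝓑, hmem, hcard, fun p hp => hvan p (hN hp)⟩
  obtain ⟨𝓑, h𝓑, -, -, hvan⟩ := main π.len le_rfl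
  obtain ⟨a, ha⟩ := h𝓑.nonempty
  simpa using hvan 1 π.one_mem a ha

end MonomialSpace

/-! ### Counting clauses and random CNFs -/

section Counting

variable {n m : ℕ}

lemma mem_threeClauses {C : Clause (Fin n)} :
    C ∈ threeClauses n ↔ C.card = 3 ∧ (clauseVars C).card = 3 := by
  simp [threeClauses, clauseVars]

/-- A clause with three distinct variables is given by the set of its positive variables. -/
lemma card_clauses_with_vars {U : Finset (Fin n)} (hU : U.card = 3) :
    ((threeClauses n).filter fun C => clauseVars C = U).card = 8 := by
  have h8 : U.powerset.card = 8 := by rw [Finset.card_powerset, hU]; norm_num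
  have hvars : ∀ P : Finset (Fin n), clauseVars (U.image fun v => (v, decide (v ∈ P))) = U := by
    intro P
    rw [clauseVars, Finset.image_image]
    exact Finset.image_id
  rw [← h8]
  refine (Finset.card_bij (fun P _ => U.image fun v => (v, decide (v ∈ P))) ?_ ?_ ?_).symm
  · intro P _
    refine Finset.mem_filter.2 ⟨mem_threeClauses.2 ⟨?_, by rw [hvars, hU]⟩, hvars P⟩
    rw [Finset.card_image_of_injective _ fun v w h => (Prod.mk.inj h).1, hU]
  · intro P hP Q hQ h
    rw [Finset.mem_powerset] at hP hQ
    have key : ∀ v ∈ U, (v ∈ P ↔ v ∈ Q) := fun v hv => by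
      have h1 := Finset.mem_image_of_mem (fun v => (v, decide (v ∈ P))) hv
      rw [h] at h1
      obtain ⟨w, -, hw⟩ := Finset.mem_image.1 h1
      obtain ⟨rfl, hw⟩ := Prod.mk.inj hw
      simpa using hw.symm
    ext v
    exact ⟨fun hv => (key v (hP hv)).1 hv, fun hv => (key v (hQ hv)).2 hv⟩
  · intro C hC
    obtain ⟨hCT, rfl⟩ := Finset.mem_filter.1 hC
    obtain ⟨h3, h3'⟩ := mem_threeClauses.1 hCT
    have hinj : Set.InjOn Prod.fst (C : Set (Literal (Fin n))) :=
      Finset.card_image_iff.1 (h3'.trans h3.symm)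
    refine ⟨(clauseVars C).filter fun v => (v, true) ∈ C,
      Finset.mem_powerset.2 (Finset.filter_subset _ _), (Finset.eq_of_subset_of_card_le ?_ ?_).symm⟩
    · rintro ⟨v, b⟩ hl
      have hv : v ∈ clauseVars C := Finset.mem_image_of_mem Prod.fst hl
      refine Finset.mem_image.2 ⟨v, hv, ?_⟩
      cases b
      · have : (v, true) ∉ C := fun h => by simpa using hinj hl h rfl
        simp [this]
      · simp [hl, hv]
    · rw [Finset.card_image_of_injective _ fun v w h => (Prod.mk.inj h).1, h3, h3']

lemma card_clauses_inside (S : Finset (Fin n)) :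
    ((threeClauses n).filter fun C => clauseVars C ⊆ S).card = 8 * S.card.choose 3 := by
  rw [Finset.card_eq_sum_card_fiberwise (f := clauseVars) (t := S.powersetCard 3)]
  · rw [Finset.sum_congr rfl (g := fun _ => 8), Finset.sum_const, Finset.card_powersetCard,
      smul_eq_mul, mul_comm]
    intro U hU
    obtain ⟨hUS, hU3⟩ := Finset.mem_powersetCard.1 hU
    rw [← card_clauses_with_vars hU3, Finset.filter_filter]
    congr 1
    ext C
    simp only [Finset.mem_filter]
    exact ⟨fun h => ⟨h.1, h.2.2⟩, fun h => ⟨h.1, by rw [h.2]; exact hUS, h.2⟩⟩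
  · intro C hC
    obtain ⟨hC, hCS⟩ := Finset.mem_filter.1 (Finset.mem_coe.1 hC)
    exact Finset.mem_coe.2 (Finset.mem_powersetCard.2 ⟨hCS, (mem_threeClauses.1 hC).2⟩)

lemma card_threeClauses (n : ℕ) : (threeClauses n).card = 8 * n.choose 3 := by
  have := card_clauses_inside (n := n) Finset.univ
  rwa [Finset.filter_true_of_mem fun C _ => Finset.subset_univ _, Finset.card_univ,
    Fintype.card_fin] at this

lemma card_threeClauses_pos (hn : 3 ≤ n) : 0 < (threeClauses n).card := by
  rw [card_threeClauses]
  exact Nat.mul_pos (by norm_num) (Nat.choose_pos hn)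

/-- An assignment satisfies at most seven eighths of all clauses. -/
lemma card_clauses_satisfied_le (a : Fin n → Bool) :
    ((threeClauses n).filter fun C => ∃ l ∈ C, a l.1 = l.2).card ≤ 7 * n.choose 3 := by
  have h1 : n.choose 3 ≤ ((threeClauses n).filter fun C => ¬ ∃ l ∈ C, a l.1 = l.2).card := by
    have : ((Finset.univ : Finset (Fin n)).powersetCard 3).card = n.choose 3 := by
      rw [Finset.card_powersetCard, Finset.card_univ, Fintype.card_fin]
    rw [← this]
    refine Finset.card_le_card_of_injOn (fun U => U.image fun v => (v, !a v)) ?_ ?_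
    · intro U hU
      have hU3 := (Finset.mem_powersetCard.1 (Finset.mem_coe.1 hU)).2
      refine Finset.mem_coe.2 (Finset.mem_filter.2 ⟨mem_threeClauses.2 ⟨?_, ?_⟩, ?_⟩)
      · rw [Finset.card_image_of_injective _ fun v w h => (Prod.mk.inj h).1, hU3]
      · rw [clauseVars, Finset.image_image]
        exact (congrArg Finset.card Finset.image_id).trans hU3
      · rintro ⟨l, hl, hal⟩
        obtain ⟨v, -, rfl⟩ := Finset.mem_image.1 hl
        simp at hal
    · intro U _ U' _ h
      have := congrArg clauseVars h
      simp only [clauseVars, Finset.image_image] at this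
      have hid : (Prod.fst ∘ fun v : Fin n => (v, !a v)) = id := rfl
      rwa [hid, Finset.image_id, Finset.image_id] at this
  have h2 := Finset.card_filter_add_card_filter_not
    (s := threeClauses n) (fun C => ∃ l ∈ C, a l.1 = l.2)
  rw [card_threeClauses] at h2
  omega

lemma choose_three_mul_le {u : ℕ} (h : u ≤ n) : u.choose 3 * n ^ 3 ≤ u ^ 3 * n.choose 3 := by
  have key : ∀ j, (u - j) * n ≤ u * (n - j) := fun j => by
    rw [Nat.sub_mul, Nat.mul_sub]
    exact Nat.sub_le_sub_left (by rw [mul_comm]; exact Nat.mul_le_mul_left _ h) _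
  have e : ∀ N : ℕ, 6 * N.choose 3 = N * (N - 1) * (N - 2) := fun N => by
    have := Nat.descFactorial_eq_factorial_mul_choose N 3
    simp only [Nat.descFactorial_succ, Nat.descFactorial_zero, Nat.factorial] at this
    norm_num at this
    rw [← this]; ring
  have h1 := Nat.mul_le_mul (key 1) (key 2)
  have h2 : 6 * (u.choose 3 * n ^ 3) ≤ 6 * (u ^ 3 * n.choose 3) := by
    calc 6 * (u.choose 3 * n ^ 3) = (6 * u.choose 3) * n ^ 3 := by ring
      _ = (u * n) * (((u - 1) * n) * ((u - 2) * n)) := by rw [e]; ring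
      _ ≤ (u * n) * ((u * (n - 1)) * (u * (n - 2))) := Nat.mul_le_mul_left _ h1
      _ = u ^ 3 * (n * (n - 1) * (n - 2)) := by ring
      _ = 6 * (u ^ 3 * n.choose 3) := by rw [← e]; ring
  omega

/-- All `m`-tuples of clauses with three distinct variables. -/
def clauseTuples (n m : ℕ) : Finset (Fin m → Clause (Fin n)) :=
  Fintype.piFinset fun _ => threeClauses n

lemma card_clauseTuples_pos (hn : 3 ≤ n) : (0 : ℝ) < (clauseTuples n m).card := by
  rw [clauseTuples, Fintype.card_piFinset, Finset.prod_const]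
  exact_mod_cast pow_pos (card_threeClauses_pos hn) _

/-- The fraction of tuples whose entries with indices in `I` lie in `P` is the corresponding
power of the fraction of clauses in `P`. -/
lemma fraction_tuples (hn : 3 ≤ n) (I : Finset (Fin m)) {P : Finset (Clause (Fin n))}
    (hP : P ⊆ threeClauses n) :
    (((clauseTuples n m).filter fun F => ∀ i ∈ I, F i ∈ P).card : ℝ) / (clauseTuples n m).card =
      ((P.card : ℝ) / (threeClauses n).card) ^ I.card := by
  have h1 : (clauseTuples n m).filter (fun F => ∀ i ∈ I, F i ∈ P) =
      Fintype.piFinset fun i => if i ∈ I then P else threeClauses n := by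
    ext F
    simp only [clauseTuples, Finset.mem_filter, Fintype.mem_piFinset]
    constructor
    · rintro ⟨h1, h2⟩ i
      split_ifs with hi
      exacts [h2 i hi, h1 i]
    · intro h
      refine ⟨fun i => ?_, fun i hi => by simpa [hi] using h i⟩
      have := h i
      split_ifs at this
      exacts [hP this, this]
  have hT : ((threeClauses n).card : ℝ) ≠ 0 := by exact_mod_cast (card_threeClauses_pos hn).ne'
  rw [h1, clauseTuples, Fintype.card_piFinset, Fintype.card_piFinset, Nat.cast_prod, Nat.cast_prod,
    ← Finset.prod_div_distrib]
  have h2 : ∀ i : Fin m, (((if i ∈ I then P else threeClauses n).card : ℝ) /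
      (threeClauses n).card) = if i ∈ I then (P.card : ℝ) / (threeClauses n).card else 1 := by
    intro i
    split_ifs
    exacts [rfl, div_self hT]
  rw [Finset.prod_congr rfl fun i _ => h2 i, Finset.prod_ite_mem, Finset.univ_inter,
    Finset.prod_const]

open Classical in
lemma randomCNFProb_eq (E : CNF (Fin n) → Prop) :
    randomCNFProb n m E = (((clauseTuples n m).filter fun F => E (Finset.univ.image F)).card : ℝ) /
      (clauseTuples n m).card := rfl

lemma randomCNFProb_le_add {E E₁ E₂ : CNF (Fin n) → Prop}
    (h : ∀ F ∈ clauseTuples n m, E (Finset.univ.image F) →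
      E₁ (Finset.univ.image F) ∨ E₂ (Finset.univ.image F)) :
    randomCNFProb n m E ≤ randomCNFProb n m E₁ + randomCNFProb n m E₂ := by
  classical
  rw [randomCNFProb_eq, randomCNFProb_eq, randomCNFProb_eq, ← add_div]
  gcongr
  rw [← Nat.cast_add]
  refine Nat.cast_le.2 (le_trans (Finset.card_le_card fun F hF => ?_) (Finset.card_union_le _ _))
  obtain ⟨hF, hE⟩ := Finset.mem_filter.1 hF
  rw [Finset.mem_union, Finset.mem_filter, Finset.mem_filter]
  exact (h F hF hE).imp (⟨hF, ·⟩) (⟨hF, ·⟩)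

lemma randomCNFProb_nonneg (E : CNF (Fin n) → Prop) : 0 ≤ randomCNFProb n m E := by
  rw [randomCNFProb_eq]; positivity

lemma randomCNFProb_le_one (E : CNF (Fin n) → Prop) : randomCNFProb n m E ≤ 1 := by
  classical
  rw [randomCNFProb_eq]
  exact div_le_one_of_le₀ (Nat.cast_le.2 (Finset.card_filter_le _ _)) (Nat.cast_nonneg _)

lemma one_le_randomCNFProb_add_not (hn : 3 ≤ n) (E : CNF (Fin n) → Prop) :
    1 ≤ randomCNFProb n m (fun φ => ¬ E φ) + randomCNFProb n m E := by
  classical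
  have h : randomCNFProb n m (fun _ => True) = 1 := by
    rw [randomCNFProb_eq, Finset.filter_true, div_self (card_clauseTuples_pos hn).ne']
  rw [← h]
  exact randomCNFProb_le_add fun F _ _ => (em _).symm

/-- First moment bound: an event implied by one of the events "all entries with indices in `I j` lie
in `P j`" has at most the sum of their probabilities. -/
lemma randomCNFProb_le_sum (hn : 3 ≤ n) {E : CNF (Fin n) → Prop} {κ : Type*} (J : Finset κ)
    (I : κ → Finset (Fin m)) (P : κ → Finset (Clause (Fin n)))
    (hP : ∀ j ∈ J, P j ⊆ threeClauses n)
    (h : ∀ F ∈ clauseTuples n m, E (Finset.univ.image F) → ∃ j ∈ J, ∀ i ∈ I j, F i ∈ P j) :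
    randomCNFProb n m E ≤ ∑ j ∈ J, (((P j).card : ℝ) / (threeClauses n).card) ^ (I j).card := by
  classical
  rw [randomCNFProb_eq, Finset.sum_congr rfl fun j hj => (fraction_tuples hn (I j) (hP j hj)).symm,
    ← Finset.sum_div]
  gcongr
  rw [← Nat.cast_sum]
  refine Nat.cast_le.2 (le_trans (Finset.card_le_card fun F hF => ?_) Finset.card_biUnion_le)
  obtain ⟨hF, hE⟩ := Finset.mem_filter.1 hF
  obtain ⟨j, hj, hjF⟩ := h F hF hE
  exact Finset.mem_biUnion.2 ⟨j, hj, Finset.mem_filter.2 ⟨hF, hjF⟩⟩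

/-! ### The satisfiability threshold is finite -/

lemma prob_satisfiable_le (hn : 3 ≤ n) :
    randomCNFProb n m Satisfiable ≤ 2 ^ n * (7 / 8 : ℝ) ^ m := by
  refine (randomCNFProb_le_sum hn (Finset.univ : Finset (Fin n → Bool)) (fun _ => Finset.univ)
    (fun a => (threeClauses n).filter fun C => ∃ l ∈ C, a l.1 = l.2)
    (fun a _ => Finset.filter_subset _ _) ?_).trans ?_
  · rintro F hF ⟨a, ha⟩
    exact ⟨a, Finset.mem_univ _, fun i _ => Finset.mem_filter.2
      ⟨Fintype.mem_piFinset.1 hF i, ha _ (Finset.mem_image_of_mem _ (Finset.mem_univ _))⟩⟩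
  · have hC : (0 : ℝ) < n.choose 3 := by exact_mod_cast Nat.choose_pos hn
    refine (Finset.sum_le_card_nsmul _ _ ((7 / 8 : ℝ) ^ m) fun a _ => ?_).trans (le_of_eq ?_)
    · rw [Finset.card_univ, Fintype.card_fin]
      refine pow_le_pow_left₀ (by positivity) ?_ m
      rw [card_threeClauses, div_le_iff₀ (by push_cast; positivity)]
      have : (((threeClauses n).filter fun C => ∃ l ∈ C, a l.1 = l.2).card : ℝ) ≤
        7 * n.choose 3 := by exact_mod_cast card_clauses_satisfied_le a
      push_cast
      linarith
    · rw [Finset.card_univ, Fintype.card_fun, Fintype.card_bool, Fintype.card_fin, nsmul_eq_mul]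
      push_cast
      ring

lemma tendsto_prob_unsat_of_six_lt {Δ : ℝ} (hΔ : 6 < Δ) :
    Tendsto (fun n : ℕ => randomCNFProb n ⌊Δ * n⌋₊ fun φ => ¬ Satisfiable φ) atTop (𝓝 1) := by
  have hlim : Tendsto (fun n : ℕ => 1 - (2 * (7 / 8 : ℝ) ^ 6) ^ n) atTop (𝓝 1) := by
    have := tendsto_pow_atTop_nhds_zero_of_lt_one (r := 2 * (7 / 8 : ℝ) ^ 6) (by positivity)
      (by norm_num)
    simpa using this.const_sub 1
  refine tendsto_of_tendsto_of_tendsto_of_le_of_le' hlim tendsto_const_nhds ?_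
    (Eventually.of_forall fun n => randomCNFProb_le_one _)
  filter_upwards [eventually_ge_atTop 3] with n hn
  have h1 := one_le_randomCNFProb_add_not (m := ⌊Δ * n⌋₊) hn Satisfiable
  have h2 := prob_satisfiable_le (m := ⌊Δ * n⌋₊) hn
  have h3 : 6 * n ≤ ⌊Δ * n⌋₊ := Nat.le_floor (by push_cast; gcongr)
  have h4 : (7 / 8 : ℝ) ^ ⌊Δ * n⌋₊ ≤ (7 / 8) ^ (6 * n) :=
    pow_le_pow_of_le_one (by norm_num) (by norm_num) h3
  have h5 : 2 ^ n * (7 / 8 : ℝ) ^ (6 * n) = (2 * (7 / 8 : ℝ) ^ 6) ^ n := by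
    rw [mul_pow, pow_mul]
  have h6 : 2 ^ n * (7 / 8 : ℝ) ^ ⌊Δ * n⌋₊ ≤ 2 ^ n * (7 / 8 : ℝ) ^ (6 * n) := by gcongr
  linarith

lemma tendsto_prob_unsat {Δ : ℝ} (hΔ : theta3 < Δ) :
    Tendsto (fun n : ℕ => randomCNFProb n ⌊Δ * n⌋₊ fun φ => ¬ Satisfiable φ) atTop (𝓝 1) := by
  rw [theta3] at hΔ
  obtain ⟨θ, hθ, hθΔ⟩ := exists_lt_of_csInf_lt
    (by exact ⟨6, fun _ h => tendsto_prob_unsat_of_six_lt h⟩) hΔ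
  exact hθ Δ hθΔ

/-! ### Expansion of random CNFs -/

/-- All sets of at most `s` clauses of `φ` expand by a factor of at least `19 / 10`. -/
def Expands {V : Type*} [DecidableEq V] (s : ℕ) (φ : CNF V) : Prop :=
  ∀ A ⊆ φ, A.card ≤ s → 19 * A.card ≤ 10 * (A.biUnion clauseVars).card

lemma prob_not_expands_le (hn : 3 ≤ n) {s : ℕ} (hs : 2 * s ≤ n) :
    randomCNFProb n m (fun φ => ¬ Expands s φ) ≤ ∑ k ∈ Finset.Icc 1 s,
      (m.choose k * n.choose (19 * k / 10) : ℝ) * (((19 * k / 10 : ℕ) : ℝ) / n) ^ (3 * k) := by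
  have hn0 : (0 : ℝ) < n := by exact_mod_cast (by omega : 0 < n)
  have hC : (0 : ℝ) < n.choose 3 := by exact_mod_cast Nat.choose_pos hn
  set J : Finset (Σ _ : ℕ, Finset (Fin m) × Finset (Fin n)) :=
    (Finset.Icc 1 s).sigma fun k => (Finset.univ.powersetCard k) ×ˢ
      (Finset.univ.powersetCard (19 * k / 10)) with hJ
  refine (randomCNFProb_le_sum hn J (fun j => j.2.1)
    (fun j => (threeClauses n).filter fun C => clauseVars C ⊆ j.2.2)
    (fun j _ => Finset.filter_subset _ _) ?_).trans ?_
  · intro F hF hE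
    simp only [Expands, not_forall, not_le] at hE
    obtain ⟨A, hA, hAs, hAexp⟩ := hE
    have h1 : ∀ C ∈ A, ∃ i, F i = C := fun C hC => by
      obtain ⟨i, -, hi⟩ := Finset.mem_image.1 (hA hC)
      exact ⟨i, hi⟩
    have hApos : 0 < A.card := by
      by_contra h0
      have : A.card = 0 := by omega
      omega
    have hne : Nonempty (Fin m) := by
      obtain ⟨C, hC⟩ := Finset.card_pos.1 hApos
      exact ⟨(h1 C hC).choose⟩
    choose! idx hidx using h1
    obtain ⟨U, hNU, -, hU⟩ := Finset.exists_subsuperset_card_eq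
      (Finset.subset_univ (A.biUnion clauseVars)) (n := 19 * A.card / 10) (by omega)
      (by rw [Finset.card_univ, Fintype.card_fin]; omega)
    refine ⟨⟨A.card, A.image idx, U⟩, ?_, fun i hi => ?_⟩
    · simp only [hJ, Finset.mem_sigma, Finset.mem_Icc, Finset.mem_product, Finset.mem_powersetCard,
        Finset.subset_univ, true_and]
      refine ⟨⟨hApos, hAs⟩, Finset.card_image_of_injOn fun C hC C' hC' h => ?_, hU⟩
      rw [← hidx C hC, ← hidx C' hC', h]
    · obtain ⟨C, hC, rfl⟩ := Finset.mem_image.1 hi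
      refine Finset.mem_filter.2 ⟨Fintype.mem_piFinset.1 hF _, ?_⟩
      rw [hidx C hC]
      exact (Finset.subset_biUnion_of_mem clauseVars hC).trans hNU
  · rw [hJ, Finset.sum_sigma]
    refine Finset.sum_le_sum fun k hk => ?_
    have hks := (Finset.mem_Icc.1 hk).2
    refine (Finset.sum_le_card_nsmul _ _
      ((((19 * k / 10 : ℕ) : ℝ) / n) ^ (3 * k)) fun j hj => ?_).trans (le_of_eq ?_)
    · obtain ⟨hj1, hj2⟩ := Finset.mem_product.1 hj
      have hj1 := (Finset.mem_powersetCard.1 hj1).2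
      have hj2 := (Finset.mem_powersetCard.1 hj2).2
      simp only [card_clauses_inside, card_threeClauses, hj1, hj2]
      rw [pow_mul]
      refine pow_le_pow_left₀ (by positivity) ?_ k
      rw [div_pow, div_le_div_iff₀ (by push_cast; positivity) (by positivity)]
      have := choose_three_mul_le (n := n) (u := 19 * k / 10) (by omega)
      have : ((19 * k / 10).choose 3 : ℝ) * n ^ 3 ≤ ((19 * k / 10 : ℕ) : ℝ) ^ 3 * n.choose 3 := by
        exact_mod_cast this
      push_cast at this ⊢
      linarith
    · rw [Finset.card_product, Finset.card_powersetCard, Finset.card_powersetCard,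
        Finset.card_univ, Finset.card_univ, Fintype.card_fin, Fintype.card_fin, nsmul_eq_mul]
      push_cast
      ring

lemma choose_le_exp_pow {N k : ℕ} (hk : 0 < k) {x : ℝ} (hx : (N : ℝ) ≤ x) :
    (N.choose k : ℝ) ≤ (Real.exp 1 * x / k) ^ k := by
  have hk' : (0 : ℝ) < k := by exact_mod_cast hk
  have hf : (0 : ℝ) < k.factorial := by exact_mod_cast k.factorial_pos
  have h1 : (N.choose k : ℝ) ≤ N ^ k / k.factorial := Nat.choose_le_pow_div k N
  have h2 : (k : ℝ) ^ k / k.factorial ≤ Real.exp 1 ^ k := by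
    have := Real.pow_div_factorial_le_exp (k : ℝ) hk'.le k
    rwa [← Real.exp_one_pow] at this
  calc (N.choose k : ℝ) ≤ N ^ k / k.factorial := h1
    _ ≤ x ^ k / k.factorial := by gcongr
    _ = ((k : ℝ) ^ k / k.factorial) * (x / k) ^ k := by
      rw [div_pow]; field_simp
    _ ≤ Real.exp 1 ^ k * (x / k) ^ k := by
      have : 0 ≤ x := (Nat.cast_nonneg N).trans hx
      gcongr
    _ = _ := by rw [← mul_pow, mul_div_assoc]

/-- The summands of the first moment bound decay geometrically: with `y = 2 * k / n`, the powers of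
`y` from the two binomial coefficients and from the probability combine to `y ^ (k / 10)`. -/
lemma expansion_term_le {k : ℕ} {D : ℝ} (hD : 1 ≤ D) (hm : (m : ℝ) ≤ D * n) (hk : 1 ≤ k)
    (hkn : 2 * k ≤ n) :
    (m.choose k * n.choose (19 * k / 10) : ℝ) * (((19 * k / 10 : ℕ) : ℝ) / n) ^ (3 * k) ≤
      (2 * D * Real.exp 1 ^ 3 * (2 * k / n : ℝ) ^ (1 / 10 : ℝ)) ^ k := by
  set u := 19 * k / 10 with hu
  set e := Real.exp 1 with he
  have he1 : 1 ≤ e := Real.one_le_exp zero_le_one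
  have hu1 : 1 ≤ u := by omega
  have hu2 : u ≤ 2 * k := by omega
  have hn0 : (0 : ℝ) < n := by exact_mod_cast (by omega : 0 < n)
  set y : ℝ := 2 * k / n with hy
  have hy0 : 0 < y := by positivity
  have hy1 : y ≤ 1 := by
    rw [hy, div_le_one hn0]
    exact_mod_cast hkn
  have huy : (u : ℝ) / n ≤ y := by
    rw [hy]
    gcongr
    exact_mod_cast hu2
  have h1 : (m.choose k : ℝ) ≤ (2 * D * e / y) ^ k := by
    refine (choose_le_exp_pow hk hm).trans (le_of_eq ?_)
    rw [hy]
    congr 1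
    field_simp
    exact he.symm
  have h2 : (n.choose u : ℝ) * ((u : ℝ) / n) ^ u ≤ e ^ (2 * k) := by
    calc (n.choose u : ℝ) * ((u : ℝ) / n) ^ u ≤ (e * n / u) ^ u * ((u : ℝ) / n) ^ u := by
          gcongr
          exact choose_le_exp_pow hu1 le_rfl
      _ = e ^ u := by
          rw [← mul_pow]
          congr 1
          field_simp
      _ ≤ e ^ (2 * k) := pow_le_pow_right₀ he1 hu2
  have h3 : y ^ (2 * k - u) ≤ (y ^ (1 / 10 : ℝ)) ^ k := by
    rw [← Real.rpow_natCast, ← Real.rpow_natCast, ← Real.rpow_mul hy0.le]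
    refine Real.rpow_le_rpow_of_exponent_ge hy0 hy1 ?_
    have h4 : k ≤ 10 * (2 * k - u) := by omega
    have h5 : (k : ℝ) ≤ 10 * ((2 * k - u : ℕ) : ℝ) := by exact_mod_cast h4
    linarith
  have hsplit : ((u : ℝ) / n) ^ (3 * k) = ((u : ℝ) / n) ^ u * ((u : ℝ) / n) ^ (3 * k - u) := by
    rw [← pow_add]
    congr 1
    omega
  have h6 : ((u : ℝ) / n) ^ (3 * k - u) ≤ y ^ k * y ^ (2 * k - u) := by
    rw [← pow_add, (by omega : k + (2 * k - u) = 3 * k - u)]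
    gcongr
  calc (m.choose k * n.choose u : ℝ) * ((u : ℝ) / n) ^ (3 * k)
      = m.choose k * (n.choose u * ((u : ℝ) / n) ^ u) * ((u : ℝ) / n) ^ (3 * k - u) := by
        rw [hsplit]; ring
    _ ≤ (2 * D * e / y) ^ k * e ^ (2 * k) * (y ^ k * y ^ (2 * k - u)) := by gcongr
    _ = (2 * D * e ^ 3) ^ k * y ^ (2 * k - u) := by
        have : (2 * D * e / y) ^ k * e ^ (2 * k) * y ^ k = (2 * D * e ^ 3) ^ k := by
          rw [pow_mul, ← mul_pow, ← mul_pow]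
          congr 1
          field_simp
        rw [← this]; ring
    _ ≤ (2 * D * e ^ 3) ^ k * (y ^ (1 / 10 : ℝ)) ^ k := by gcongr
    _ = _ := by rw [← mul_pow]

lemma exists_tendsto_prob_not_expands (Δ : ℝ) :
    ∃ δ : ℝ, 0 < δ ∧ δ ≤ 1 ∧
      Tendsto (fun n : ℕ => randomCNFProb n ⌊Δ * n⌋₊ fun φ => ¬ Expands ⌊δ * n⌋₊ φ)
        atTop (𝓝 0) := by
  set D := max Δ 1 with hD
  have hD1 : 1 ≤ D := le_max_right _ _
  set K := 2 * D * Real.exp 1 ^ 3 with hK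
  have hK0 : 0 < K := by positivity
  have hK1 : 1 ≤ K := by
    have : 1 ≤ Real.exp 1 ^ 3 := one_le_pow₀ (Real.one_le_exp zero_le_one)
    rw [hK]; nlinarith
  -- `δ` is chosen so that `K * (2 * δ) ^ (1 / 10) = 1 / 2`
  set δ := (1 / (2 * K)) ^ 10 / 2 with hδ
  have hδ0 : 0 < δ := by positivity
  have hδ1 : 2 * δ ≤ 1 := by
    have : (1 / (2 * K)) ^ 10 ≤ 1 := by
      refine pow_le_one₀ (by positivity) ?_
      rw [div_le_one (by positivity)]
      linarith
    rw [hδ]; linarith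
  have hδK : K * (2 * δ) ^ (1 / 10 : ℝ) = 1 / 2 := by
    have h1 : 2 * δ = (1 / (2 * K)) ^ 10 := by rw [hδ]; ring
    rw [h1, ← Real.rpow_natCast, ← Real.rpow_mul (by positivity)]
    norm_num
    field_simp
  refine ⟨δ, hδ0, by linarith, ?_⟩
  have hsum : Summable fun k : ℕ => (k : ℝ) * (1 / 2 : ℝ) ^ k := by
    simpa using summable_pow_mul_geometric_of_norm_lt_one 1 (r := (1 / 2 : ℝ)) (by norm_num)
  set S := ∑' k : ℕ, (k : ℝ) * (1 / 2 : ℝ) ^ k with hS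
  have hlim : Tendsto (fun n : ℕ => 4 * K * S * (n : ℝ) ^ (-(1 / 10) : ℝ)) atTop (𝓝 0) := by
    have := (tendsto_rpow_neg_atTop (show (0 : ℝ) < 1 / 10 by norm_num)).comp
      tendsto_natCast_atTop_atTop
    simpa using this.const_mul (4 * K * S)
  refine tendsto_of_tendsto_of_tendsto_of_le_of_le' tendsto_const_nhds hlim
    (Eventually.of_forall fun n => randomCNFProb_nonneg _) ?_
  filter_upwards [eventually_ge_atTop 3] with n hn
  have hn0 : (0 : ℝ) < n := by exact_mod_cast (by omega : 0 < n)
  have hs : (⌊δ * n⌋₊ : ℝ) ≤ δ * n := Nat.floor_le (by positivity)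
  have h2s : 2 * ⌊δ * n⌋₊ ≤ n := by
    have : (2 * ⌊δ * n⌋₊ : ℝ) ≤ n := by nlinarith
    exact_mod_cast this
  have hm : (⌊Δ * n⌋₊ : ℝ) ≤ D * n := by
    calc (⌊Δ * n⌋₊ : ℝ) ≤ ⌊D * n⌋₊ := by gcongr; exact le_max_left _ _
      _ ≤ D * n := Nat.floor_le (by positivity)
  refine (prob_not_expands_le hn h2s).trans ?_
  have hterm : ∀ k ∈ Finset.Icc 1 ⌊δ * n⌋₊,
      (⌊Δ * n⌋₊.choose k * n.choose (19 * k / 10) : ℝ) *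
        (((19 * k / 10 : ℕ) : ℝ) / n) ^ (3 * k) ≤
      4 * K * (n : ℝ) ^ (-(1 / 10) : ℝ) * (k * (1 / 2 : ℝ) ^ k) := by
    intro k hk
    obtain ⟨hk1, hks⟩ := Finset.mem_Icc.1 hk
    have hk0 : (1 : ℝ) ≤ k := by exact_mod_cast hk1
    refine (expansion_term_le hD1 hm hk1 (by omega)).trans ?_
    rw [← hK]
    set y : ℝ := 2 * k / n with hy
    have hy0 : 0 ≤ y := by positivity
    have hyδ : y ≤ 2 * δ := by
      rw [hy, div_le_iff₀ hn0]
      have : (k : ℝ) ≤ ⌊δ * n⌋₊ := by exact_mod_cast hks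
      linarith
    have hhalf : K * y ^ (1 / 10 : ℝ) ≤ 1 / 2 := by
      rw [← hδK]
      gcongr
    have hyn : y ^ (1 / 10 : ℝ) ≤ 2 * k * (n : ℝ) ^ (-(1 / 10) : ℝ) := by
      rw [hy, Real.div_rpow (by positivity) hn0.le, Real.rpow_neg hn0.le, ← div_eq_mul_inv]
      gcongr
      calc (2 * k : ℝ) ^ (1 / 10 : ℝ) ≤ (2 * k : ℝ) ^ (1 : ℝ) :=
            Real.rpow_le_rpow_of_exponent_le (by linarith) (by norm_num)
        _ = 2 * k := Real.rpow_one _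
    obtain ⟨j, rfl⟩ := Nat.exists_eq_succ_of_ne_zero (by omega : k ≠ 0)
    calc (K * y ^ (1 / 10 : ℝ)) ^ (j + 1)
        = (K * y ^ (1 / 10 : ℝ)) ^ j * (K * y ^ (1 / 10 : ℝ)) := pow_succ _ _
      _ ≤ (1 / 2) ^ j * (K * (2 * (j + 1 : ℕ) * (n : ℝ) ^ (-(1 / 10) : ℝ))) := by gcongr
      _ = _ := by rw [Nat.succ_eq_add_one, pow_succ]; ring
  calc _ ≤ ∑ k ∈ Finset.Icc 1 ⌊δ * n⌋₊,
        4 * K * (n : ℝ) ^ (-(1 / 10) : ℝ) * (k * (1 / 2 : ℝ) ^ k) := Finset.sum_le_sum hterm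
    _ = 4 * K * (n : ℝ) ^ (-(1 / 10) : ℝ) *
        ∑ k ∈ Finset.Icc 1 ⌊δ * n⌋₊, (k * (1 / 2 : ℝ) ^ k) := by rw [Finset.mul_sum]
    _ ≤ 4 * K * (n : ℝ) ^ (-(1 / 10) : ℝ) * S := by
        gcongr
        exact hsum.sum_le_tsum _ fun k _ => by positivity
    _ = _ := by ring

end Counting

/-! ### The space lower bounds -/

/-- Every CNF with three variables in each clause in which all small sets of clauses expand has an
extendible family of the corresponding rank. -/
lemma exists_extendible {n m s r : ℕ} {F : Fin m → Clause (Fin n)} (hF : F ∈ clauseTuples n m)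
    (hexp : Expands s (Finset.univ.image F)) (hr : 960 * r + 692 ≤ s) :
    ∃ 𝓕, Extendible (Finset.univ.image F) r 𝓕 := by
  refine ⟨_, extendible_goodFamily (fun C hC => ?_) hexp hr⟩
  obtain ⟨i, -, rfl⟩ := Finset.mem_image.1 hC
  exact (mem_threeClauses.1 (Fintype.mem_piFinset.1 hF i)).2.le

end ProofSpace

theorem mainTheorem8 (Δ : ℝ) (hΔ : theta3 < Δ) :
    ∃ c : ℝ, 0 < c ∧
      Tendsto (fun n : ℕ => randomCNFProb n ⌊Δ * n⌋₊ fun φ =>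
          ¬ Satisfiable φ ∧
          (∀ (𝔽 : Type*) [Field 𝔽] (π : SemPCRRefutation (tr 𝔽 φ)),
            ENNReal.ofReal (c * (n / Real.log n)) ≤ (π.monomialSpace : ℝ≥0∞)) ∧
          (∀ π : ResRefutation φ,
            (∃ i ≤ π.len, c * (n / Real.log n) ≤
              (((π.mem i).filter fun C => c * (n / Real.log n) ≤ (C.card : ℝ)).card : ℝ)) ∧
            c * ((n : ℝ) ^ 2 / Real.log n ^ 2) ≤ (π.totalSpace : ℝ)))
        atTop (𝓝 1) := by
  obtain ⟨δ, hδ0, hδ1, hlim⟩ := exists_tendsto_prob_not_expands Δ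
  -- the square makes `c` small enough for the bound on total space, too
  set d := δ / 8000 with hd
  have hd0 : 0 < d := by positivity
  have hd1 : d ≤ 1 := by rw [hd]; linarith
  refine ⟨d ^ 2, by positivity, ?_⟩
  have hlow := (tendsto_prob_unsat hΔ).sub hlim
  rw [sub_zero] at hlow
  refine tendsto_of_tendsto_of_tendsto_of_le_of_le' hlow tendsto_const_nhds ?_
    (Eventually.of_forall fun n => randomCNFProb_le_one _)
  filter_upwards [eventually_ge_atTop 3, eventually_ge_atTop ⌈10000 / δ⌉₊] with n hn hn'
  rw [sub_le_iff_le_add]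
  refine randomCNFProb_le_add fun F hF hunsat => ?_
  by_cases hexp : Expands ⌊δ * n⌋₊ (Finset.univ.image F)
  swap
  · exact Or.inr hexp
  refine Or.inl ⟨hunsat, ?_⟩
  have hn0 : (0 : ℝ) < n := by exact_mod_cast (by omega : 0 < n)
  have hnδ : 10000 ≤ δ * n := by
    have := (Nat.le_ceil _).trans (Nat.cast_le.2 hn' : ((⌈10000 / δ⌉₊ : ℕ) : ℝ) ≤ n)
    rwa [div_le_iff₀ hδ0, mul_comm] at this
  set q := ⌈d * n⌉₊ with hq
  have hqn : d * n ≤ q := Nat.le_ceil _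
  have hqs : 960 * (4 * q) + 692 ≤ ⌊δ * n⌋₊ := by
    refine Nat.le_floor ?_
    have h1 : (q : ℝ) < d * n + 1 := Nat.ceil_lt_add_one (by positivity)
    push_cast
    rw [hd] at h1
    linarith
  have hlog : 1 ≤ Real.log n := by
    rw [Real.le_log_iff_exp_le hn0]
    have : (3 : ℝ) ≤ n := by exact_mod_cast hn
    linarith [Real.exp_one_lt_d9]
  have hdiv : (n : ℝ) / Real.log n ≤ n := div_le_self hn0.le hlog
  have hq1 : d ^ 2 * (n / Real.log n) ≤ q := by
    refine le_trans ?_ hqn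
    have : d ^ 2 ≤ d := by nlinarith
    gcongr
  have hq2 : d ^ 2 * ((n : ℝ) ^ 2 / Real.log n ^ 2) ≤ q * q := by
    rw [← div_pow, ← mul_pow, sq]
    have : d * (n / Real.log n) ≤ q := le_trans (by gcongr) hqn
    gcongr
  obtain ⟨𝓕, h𝓕⟩ := exists_extendible hF hexp hqs
  have : Nonempty (Fin n) := ⟨⟨0, by omega⟩⟩
  refine ⟨fun 𝔽 _ π => ?_, fun π => ?_⟩
  · have h1 := π.le_monomialSpace h𝓕 le_rfl
    calc ENNReal.ofReal (d ^ 2 * (n / Real.log n)) ≤ ENNReal.ofReal q :=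
          ENNReal.ofReal_le_ofReal hq1
      _ = ((q : ℕ∞) : ℝ≥0∞) := by simp
      _ ≤ (π.monomialSpace : ℝ≥0∞) := ENat.toENNReal_le.2 h1
  · obtain ⟨i, hi, hwide⟩ := π.exists_many_wide h𝓕 (m := q) (k := q) (by omega)
    refine ⟨⟨i, hi, hq1.trans (Nat.cast_le.2
      (hwide.trans (Finset.card_le_card fun C hC => ?_)))⟩, ?_⟩
    · obtain ⟨hC, hqC⟩ := Finset.mem_filter.1 hC
      exact Finset.mem_filter.2 ⟨hC, hq1.trans (Nat.cast_le.2 hqC.le)⟩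
    · have := π.le_totalSpace hi hwide
      exact hq2.trans (by exact_mod_cast this)
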